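/- Let $p \ge 5$ be a prime, let $V$ be a finite elementary abelian $p$-group, let $G$ be a finite $p$-group acting faithfully on $V$, and let $S = V \rtimes G$, with $V$ and $G$ regarded as subgroups of $S$ and with canonical projection $\pi\colon S \to G$. For a subgroup $B \le S$ put $B_\times = (B\cap V)\,\pi(B)$, which is a subgroup of $S$, and call $B$ a product subgroup if $B = B_\times$. Let $\mathcal{A}(S)$ be the set of abelian subgroups of $S$ of maximum order, and let $$\mathcal{A}_\times(S) = \{A \in \mathcal{A}(S) \mid A = A_\times \text{ and } A \nleq V\}.$$ Let $1 = Z_0 \le Z_1 \le \cdots \le Z_n = S$ be a central series of $S$ such that $Z_j = V$ for some $j$. Let $A \in \mathcal{A}_\times(S)$ be maximal with respect to this series, that is, there is no $A' \in \mathcal{A}_\times(S)$ such that $|A| = |A'|$, $|A\cap Z_i| \le |A'\cap Z_i|$ for all $1\le i\le n$, and $|A \cap Z_i| < |A'\cap Z_i|$ for some $1 \le i \le n$. Then $A$ is normalized by every product subgroup $B$ of $S$ such that $A$ is normal in $\langle A^B\rangle = \langle b^{-1}Ab \mid b \in B\rangle$ and $[A,u;3] = 1$ for all $u \in B$. Here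 $[X,u] = \langle x^{-1}u^{-1}xu \mid x \in X\rangle$ for a subgroup $X \le S$ and $u \in S$, and $[A,u;3] = [[[A,u],u],u]$. -/

import Mathlib

namespace ProductSubgroups

section General

variable {S : Type*} [Group S]

/-- `A ∈ 𝒜(S)`: `A` is an abelian subgroup of `S` of maximum order. -/
def IsAbelianOfMaxOrder (A : Subgroup S) : Prop :=
  IsMulCommutative A ∧ ∀ B : Subgroup S, IsMulCommutative B → Nat.card B ≤ Nat.card A

/-- A central series `1 = Z 0 ≤ Z 1 ≤ ⋯ ≤ Z n = S`. The condition `[Z (i + 1), S] ≤ Z i`, together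
with `Z i ≤ Z (i + 1)`, says that the terms are normal and that `Z (i + 1) / Z i` is central in
`S / Z i`. Only the terms `Z i` with `i ≤ n` are part of the series. -/
structure IsCentralSeries (n : ℕ) (Z : ℕ → Subgroup S) : Prop where
  bot : Z 0 = ⊥
  top : Z n = ⊤
  le_succ : ∀ i < n, Z i ≤ Z (i + 1)
  commutator_le : ∀ i < n, ⁅Z (i + 1), (⊤ : Subgroup S)⁆ ≤ Z i

/-- `A ≤_Z B`: `|A| = |B|` and `|A ∩ Z i| ≤ |B ∩ Z i|` for `1 ≤ i ≤ n`. -/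
def SeriesLE (n : ℕ) (Z : ℕ → Subgroup S) (A B : Subgroup S) : Prop :=
  Nat.card A = Nat.card B ∧
    ∀ i, 1 ≤ i → i ≤ n → Nat.card ↥(A ⊓ Z i) ≤ Nat.card ↥(B ⊓ Z i)

/-- `A <_Z B`: `A ≤_Z B` and `|A ∩ Z i| < |B ∩ Z i|` for some `1 ≤ i ≤ n`. -/
def SeriesLT (n : ℕ) (Z : ℕ → Subgroup S) (A B : Subgroup S) : Prop :=
  SeriesLE n Z A B ∧
    ∃ i, 1 ≤ i ∧ i ≤ n ∧ Nat.card ↥(A ⊓ Z i) < Nat.card ↥(B ⊓ Z i)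

/-- `A` is maximal in the collection `C` with respect to the series `Z`. -/
def IsSeriesMaximal (n : ℕ) (Z : ℕ → Subgroup S) (C : Set (Subgroup S)) (A : Subgroup S) : Prop :=
  A ∈ C ∧ ¬ ∃ B ∈ C, SeriesLT n Z A B

/-- `[X, u] = ⟨[x, u] : x ∈ X⟩`, with `[x, u] = x⁻¹ u⁻¹ x u`. -/
def commElement (X : Subgroup S) (u : S) : Subgroup S :=
  Subgroup.closure {c | ∃ x ∈ X, c = x⁻¹ * u⁻¹ * x * u}

/-- `[X, u; k]`: `[X, u; 0] = X` and `[X, u; k + 1] = [[X, u; k], u]`. -/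
def iterCommElement (X : Subgroup S) (u : S) : ℕ → Subgroup S
  | 0 => X
  | k + 1 => commElement (iterCommElement X u k) u

/-- `⟨A ^ B⟩`: the subgroup generated by the conjugates `b⁻¹ A b`, `b ∈ B`. -/
def conjClosure (A B : Subgroup S) : Subgroup S :=
  Subgroup.closure {c | ∃ a ∈ A, ∃ b ∈ B, c = b⁻¹ * a * b}

end General

section Semidirect

variable {V G : Type*} [CommGroup V] [Group G] {φ : G →* MulAut V}

/-- The normal subgroup `V` of `S = V ⋊ G`. -/
def baseSubgroup (φ : G →* MulAut V) : Subgroup (V ⋊[φ] G) :=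
  (SemidirectProduct.inl : V →* V ⋊[φ] G).range

/-- The image `π(B)` of `B` under the projection `π : S → G`, where `G` is regarded as a subgroup of
`S = V ⋊ G`. -/
def projSubgroup (B : Subgroup (V ⋊[φ] G)) : Subgroup (V ⋊[φ] G) :=
  (B.map SemidirectProduct.rightHom).map SemidirectProduct.inr

/-- The subgroup `B_× = (B ∩ V) π(B)` of `S = V ⋊ G`; by `coe_timesSubgroup` the join is the
product set. -/
def timesSubgroup (B : Subgroup (V ⋊[φ] G)) : Subgroup (V ⋊[φ] G) :=
  (B ⊓ baseSubgroup φ) ⊔ projSubgroup B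

open scoped Pointwise in
theorem coe_timesSubgroup (B : Subgroup (V ⋊[φ] G)) :
    (timesSubgroup B : Set (V ⋊[φ] G)) =
      ((B ⊓ baseSubgroup φ : Subgroup (V ⋊[φ] G)) : Set (V ⋊[φ] G)) * (projSubgroup B : Set _) := by
  apply Subgroup.coe_mul_of_right_le_normalizer_left
  have key : ∀ h ∈ projSubgroup B, ∀ n ∈ B ⊓ baseSubgroup φ,
      h * n * h⁻¹ ∈ B ⊓ baseSubgroup φ := by
    rintro _ ⟨_, ⟨b, hb, rfl⟩, rfl⟩ _ ⟨hn, ⟨v, rfl⟩⟩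
    have e : (SemidirectProduct.inr (SemidirectProduct.rightHom b) : V ⋊[φ] G) *
        SemidirectProduct.inl v * (SemidirectProduct.inr (SemidirectProduct.rightHom b))⁻¹ =
        b * SemidirectProduct.inl v * b⁻¹ := by
      ext <;> simp [mul_comm]
    rw [e]
    refine ⟨B.mul_mem (B.mul_mem hb hn) (B.inv_mem hb), φ b.right v, ?_⟩
    ext <;> simp [mul_comm]
  intro h hh
  rw [Subgroup.mem_normalizer_iff]
  intro n
  refine ⟨key h hh n, fun hn => ?_⟩
  have := key h⁻¹ ((projSubgroup B).inv_mem hh) _ hn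
  simpa [mul_assoc] using this

/-- `B` is a product subgroup of `S = V ⋊ G` if `B = B_×`. -/
def IsProductSubgroup (B : Subgroup (V ⋊[φ] G)) : Prop :=
  B = timesSubgroup B

/-- `𝒜_×(S)`: the product subgroups, not contained in `V`, among the abelian subgroups of maximum
order of `S = V ⋊ G`. -/
def abelianProductSubgroups (φ : G →* MulAut V) : Set (Subgroup (V ⋊[φ] G)) :=
  {A | IsAbelianOfMaxOrder A ∧ IsProductSubgroup A ∧ ¬ A ≤ baseSubgroup φ}

/-- `ℬ_A`: the product subgroups `B` with `A ⊴ ⟨A ^ B⟩` and `[A, u; 3] = 1` for all `u ∈ B`. -/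
def normalizingCandidates (A : Subgroup (V ⋊[φ] G)) : Set (Subgroup (V ⋊[φ] G)) :=
  {B | IsProductSubgroup B ∧ (A.subgroupOf (conjClosure A B)).Normal ∧
    ∀ u ∈ B, iterCommElement A u 3 = ⊥}

end Semidirect

end ProductSubgroups

/-! ### Counting tools. -/

namespace ProductSubgroups

/-! An abelian product subgroup of `V ⋊ G` is a pair `(U, H)`, where `U` is a subspace of `V` and
`H` an abelian subgroup of `G` fixing `U` pointwise. Let `A` correspond to `(U, H)`. A product
subgroup `B` is generated by its parts in `V` and in `G`, so each part can be treated separately.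

For `V`, Thompson replacement (`map_sub_mem_of_triple`) and induction along the series give `[V, H]
≤ U`. Hence `V` normalizes `A`, and `(ρ a - 1) (ρ b - 1) = 0` for `a, b ∈ H`, so that `N = {ρ a - 1
| a ∈ H}` is a vector space with zero multiplication.

For `h` in the `G`-part of `B`, the condition `[A, h⁻¹; 3] = 1` makes the action `T` of `h` on `U`
and on `N` satisfy `(T - 1) ^ 3 = 0`, so `T ^ t = 1 + t E + t² F`. As in a degeneration to the limit
`t → ∞`, `U` and `N` are replaced by their spaces of leading coefficients. These are at least as
large (`card_le_card_limitSpace`). They still annihilate each other, because the relations are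
polynomials of degree at most 4 in `t` that vanish at `0, …, 4` (`apply_limitSpace_eq_zero_of_pow`).
The limit `L` of `N` again comes from a subgroup of `G`: normality of `A` in `⟨A ^ B⟩` kills the
products `x y x`, and a truncated Baker–Campbell–Hausdorff formula realizes each `1 + q`, `q ∈ L`,
in `G` (`exists_map_eq_one_add_add`).

The limit pair is thus a competitor of `A` whose intersections with the series are no smaller.
Maximality forces equality, so taking limits commutes with intersecting with the series. Induction
up the series then shows that `h` preserves `U` and `N` (`IsMaximalPair.stable`). -/

theorem card_le_card_mul_of_fiber {α β : Type*} [Finite α] [Finite β] (f : α → β) (c : ℕ)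
    (h : ∀ x : α, Nat.card {y // f y = f x} ≤ c) : Nat.card α ≤ Nat.card β * c := by
  classical
  have := Fintype.ofFinite β
  rw [← Nat.card_congr (Equiv.sigmaFiberEquiv f), Nat.card_sigma, Nat.card_eq_fintype_card,
    ← smul_eq_mul, ← Finset.card_univ]
  refine Finset.sum_le_card_nsmul _ _ _ fun b _ => ?_
  by_cases hb : ∃ x, f x = b
  · obtain ⟨x, rfl⟩ := hb
    exact h x
  · have : IsEmpty {y // f y = b} := ⟨fun y => hb ⟨y.1, y.2⟩⟩
    simp

/-- If `a ≥ b + 1`, Bernoulli's inequality for `(1 + 1 / b) ^ N` with `N = b * b ^ k` gives at least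
`1 + b ^ k`, which exceeds the slack `b ^ k`. A bounded loss in the exponent is therefore harmless.
-/
theorem le_of_forall_pow_le_pow_add {a b k : ℕ} (h : ∀ N, a ^ N ≤ b ^ (N + k)) : a ≤ b := by
  by_contra! hab
  rcases Nat.eq_zero_or_pos b with rfl | hb
  · have := h 1
    rw [zero_pow (by omega), pow_one] at this
    omega
  have hb' : (0 : ℝ) < b := by exact_mod_cast hb
  have h1 := h (b * b ^ k)
  have h2 : (b + 1) ^ (b * b ^ k) ≤ b ^ (b * b ^ k) * b ^ k :=
    (Nat.pow_le_pow_left hab _).trans (h1.trans (pow_add _ _ _).le)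
  have h3 : ((b : ℝ) + 1) ^ (b * b ^ k) ≤ (b : ℝ) ^ (b * b ^ k) * (b : ℝ) ^ k := by
    exact_mod_cast h2
  have h4 : ((b : ℝ) + 1) = b * (1 + 1 / b) := by field_simp
  rw [h4, mul_pow] at h3
  have h5 := le_of_mul_le_mul_left h3 (by positivity)
  have h6 := one_add_mul_le_pow (a := (1 / b : ℝ)) (by linarith [one_div_pos.2 hb']) (b * b ^ k)
  have h7 : ((b * b ^ k : ℕ) : ℝ) * (1 / b) = (b : ℝ) ^ k := by push_cast; field_simp
  rw [h7] at h6
  linarith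

/-! ### Limits of subspaces under a quadratic one-parameter family. -/

section Limit

variable {K M : Type*} [Field K] [AddCommGroup M] [Module K M]

/-- The coefficients of `(1 + t E + t² F) (∑ a k t ^ k)`. -/
def twist (E F : M →ₗ[K] M) (a : ℕ → M) : ℕ → M
  | 0 => a 0
  | 1 => a 1 + E (a 0)
  | k + 2 => a (k + 2) + E (a (k + 1)) + F (a k)

theorem twist_add (E F : M →ₗ[K] M) (a b : ℕ → M) (k : ℕ) :
    twist E F (a + b) k = twist E F a k + twist E F b k := by
  rcases k with _ | _ | k <;> simp [twist] <;> abel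

theorem twist_sub (E F : M →ₗ[K] M) (a b : ℕ → M) (k : ℕ) :
    twist E F (a - b) k = twist E F a k - twist E F b k := by
  rcases k with _ | _ | k <;> simp [twist] <;> abel

theorem twist_smul (E F : M →ₗ[K] M) (c : K) (a : ℕ → M) (k : ℕ) :
    twist E F (c • a) k = c • twist E F a k := by
  rcases k with _ | _ | k <;> simp [twist]

theorem twist_zero (E F : M →ₗ[K] M) (k : ℕ) : twist E F (0 : ℕ → M) k = 0 := by
  rcases k with _ | _ | k <;> simp [twist]

theorem twist_eq_zero {E F : M →ₗ[K] M} {a : ℕ → M} (h : ∀ k, twist E F a k = 0) (k : ℕ) :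
    a k = 0 := by
  induction k using Nat.strong_induction_on with
  | _ k ih =>
    have := h k
    rcases k with _ | _ | k
    · exact this
    · simpa [twist, ih 0] using this
    · simpa [twist, ih (k + 1), ih k] using this

/-- The limit of the subspaces `(1 + t E + t² F) A` for `t → ∞`: the space of leading coefficients
of the elements of `(1 + t E + t² F) A[t]`, where `t ^ 2` stands for the leading power. -/
def limitSpace (E F : M →ₗ[K] M) (A : Submodule K M) : Submodule K M where
  carrier := {x | ∃ a : ℕ → M, (∀ k, a k ∈ A) ∧ (∃ N, ∀ k, N ≤ k → a k = 0) ∧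
    (∀ k, 3 ≤ k → twist E F a k = 0) ∧ twist E F a 2 = x}
  add_mem' := by
    rintro _ _ ⟨a, ha, ⟨N, hN⟩, h, rfl⟩ ⟨a', ha', ⟨N', hN'⟩, h', rfl⟩
    refine ⟨a + a', fun k => A.add_mem (ha k) (ha' k), ⟨max N N', fun k hk => ?_⟩,
      fun k hk => ?_, twist_add ..⟩
    · simp [hN k (le_trans (le_max_left _ _) hk), hN' k (le_trans (le_max_right _ _) hk)]
    · rw [twist_add, h k hk, h' k hk, add_zero]
  zero_mem' := ⟨0, fun _ => A.zero_mem, ⟨0, fun _ _ => rfl⟩, fun _ _ => twist_zero ..,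
    twist_zero ..⟩
  smul_mem' := by
    rintro c _ ⟨a, ha, ⟨N, hN⟩, h, rfl⟩
    refine ⟨c • a, fun k => A.smul_mem c (ha k), ⟨N, fun k hk => ?_⟩, fun k hk => ?_,
      twist_smul ..⟩
    · simp [hN k hk]
    · rw [twist_smul, h k hk, smul_zero]

theorem limitSpace_mono (E F : M →ₗ[K] M) {A A' : Submodule K M} (h : A ≤ A') :
    limitSpace E F A ≤ limitSpace E F A' := by
  rintro _ ⟨a, ha, hN, h0, rfl⟩
  exact ⟨a, fun k => h (ha k), hN, h0, rfl⟩

theorem exists_of_mem_limitSpace {E F : M →ₗ[K] M} {A : Submodule K M} {x : M}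
    (hx : x ∈ limitSpace E F A) : ∃ a ∈ A, ∃ b ∈ A, ∃ c ∈ A, x = a + E b + F c := by
  obtain ⟨a, ha, -, -, rfl⟩ := hx
  exact ⟨a 2, ha 2, a 1, ha 1, a 0, ha 0, rfl⟩

theorem limitSpace_le {E F : M →ₗ[K] M} {A B : Submodule K M} (hAB : A ≤ B)
    (hE : ∀ x ∈ A, E x ∈ B) (hF : ∀ x ∈ A, F x ∈ B) : limitSpace E F A ≤ B := by
  intro x hx
  obtain ⟨a, ha, b, hb, c, hc, rfl⟩ := exists_of_mem_limitSpace hx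
  exact B.add_mem (B.add_mem (hAB ha) (hE b hb)) (hF c hc)

theorem apply_two_mem_limitSpace {E F : M →ₗ[K] M} {A : Submodule K M} {x : M} (hx : x ∈ A) :
    F x ∈ limitSpace E F A := by
  refine ⟨fun k => if k = 0 then x else 0, fun k => ?_, ⟨1, fun k hk => ?_⟩, fun k hk => ?_, ?_⟩
  · dsimp only
    split_ifs
    exacts [hx, A.zero_mem]
  · simp [show k ≠ 0 by omega]
  · obtain ⟨k, rfl⟩ := Nat.exists_eq_add_of_le' hk
    simp [twist]
  · simp [twist]

/-- The sequence with `x` at index 1 has the unwanted coefficient `F x` at index 3. The entry `-F x`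
at index 3 cancels it, and its own images under `E` and `F` vanish. -/
theorem apply_one_mem_limitSpace {E F : M →ₗ[K] M} {A : Submodule K M} {x : M} (hx : x ∈ A)
    (hFx : F x ∈ A) (hEF : E (F x) = 0) (hFF : F (F x) = 0) : E x ∈ limitSpace E F A := by
  refine ⟨fun k => if k = 1 then x else if k = 3 then - F x else 0, fun k => ?_,
    ⟨4, fun k hk => ?_⟩, fun k hk => ?_, ?_⟩
  · dsimp only
    split_ifs
    exacts [hx, A.neg_mem hFx, A.zero_mem]
  · simp [show k ≠ 1 by omega, show k ≠ 3 by omega]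
  · obtain ⟨k, rfl⟩ := Nat.exists_eq_add_of_le' hk
    rcases k with _ | _ | _ | k <;> simp [twist, hEF, hFF]
  · simp [twist]

/-- A polynomial is determined by its top coefficient and its difference from a chosen polynomial
with the same top coefficient. Finiteness is carried along because `Nat.card` of an infinite type is
`0`. -/
theorem card_leading_le [Finite M] (Y : Submodule K M) (Q : Submodule K (ℕ → M))
    (hY : ∀ f ∈ Q, ∀ m, (∀ k, m < k → f k = 0) → f m ∈ Y) (n : ℕ) :
    Finite {f : Q // ∀ k, n ≤ k → f.1 k = 0} ∧
      Nat.card {f : Q // ∀ k, n ≤ k → f.1 k = 0} ≤ Nat.card Y ^ n := by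
  induction n with
  | zero =>
    have : Subsingleton {f : Q // ∀ k, 0 ≤ k → f.1 k = 0} :=
      ⟨fun f g => Subtype.ext (Subtype.ext (funext fun k => by
        rw [f.2 k (Nat.zero_le _), g.2 k (Nat.zero_le _)]))⟩
    exact ⟨inferInstance, by rw [pow_zero]; exact Finite.card_le_one_iff_subsingleton.2 this⟩
  | succ n ih =>
    have := ih.1
    let c : {f : Q // ∀ k, n + 1 ≤ k → f.1 k = 0} → Y := fun f =>
      ⟨f.1.1 n, hY _ f.1.2 n fun k hk => f.2 k hk⟩
    have sec : ∀ y : Y, ∃ g : {f : Q // ∀ k, n + 1 ≤ k → f.1 k = 0},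
        (∃ f, c f = y) → c g = y := by
      intro y
      by_cases h : ∃ f, c f = y
      · exact ⟨h.choose, fun _ => h.choose_spec⟩
      · exact ⟨⟨0, fun _ _ => rfl⟩, fun h' => absurd h' h⟩
    choose s hs using sec
    let F : {f : Q // ∀ k, n + 1 ≤ k → f.1 k = 0} →
        Y × {f : Q // ∀ k, n ≤ k → f.1 k = 0} := fun f =>
      (c f, ⟨f.1 - (s (c f)).1, by
        intro k hk
        rcases hk.eq_or_lt with rfl | hk
        · have := congrArg Subtype.val (hs (c f) ⟨f, rfl⟩)
          simp only [c] at this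
          simp [this, c]
        · simp [f.2 k hk, (s (c f)).2 k hk]⟩)
    have hF : Function.Injective F := by
      intro f g hfg
      have h1 : c f = c g := congrArg Prod.fst hfg
      have h2 : f.1 - (s (c f)).1 = g.1 - (s (c g)).1 :=
        congrArg (fun z => z.2.1) hfg
      rw [h1] at h2
      exact Subtype.ext (sub_left_injective h2)
    refine ⟨Finite.of_injective F hF, (Nat.card_le_card_of_injective F hF).trans ?_⟩
    rw [Nat.card_prod, pow_succ, mul_comm]
    exact Nat.mul_le_mul_right _ ih.2

/-- The twist is injective and raises degrees by at most 2, so `|A| ^ N` polynomials embed into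
those of degree below `N + 4` with leading coefficients in the limit. Counting replaces a dimension
argument. -/
theorem card_le_card_limitSpace [Finite M] (E F : M →ₗ[K] M) (A : Submodule K M) :
    Nat.card A ≤ Nat.card (limitSpace E F A) := by
  refine le_of_forall_pow_le_pow_add (k := 4) fun N => ?_
  let Q : Submodule K (ℕ → M) :=
    { carrier := {f | ∃ a : ℕ → M, (∀ k, a k ∈ A) ∧ a 0 = 0 ∧ a 1 = 0 ∧
        (∃ N, ∀ k, N ≤ k → a k = 0) ∧ ∀ k, f k = twist E F a k}
      add_mem' := by
        rintro f f' ⟨a, ha, h0, h1, ⟨N, hN⟩, h⟩ ⟨a', ha', h0', h1', ⟨N', hN'⟩, h'⟩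
        refine ⟨a + a', fun k => A.add_mem (ha k) (ha' k), by simp [h0, h0'], by simp [h1, h1'],
          ⟨max N N', fun k hk => ?_⟩, fun k => ?_⟩
        · simp [hN k (le_trans (le_max_left _ _) hk), hN' k (le_trans (le_max_right _ _) hk)]
        · rw [twist_add, ← h, ← h', Pi.add_apply]
      zero_mem' := ⟨0, fun _ => A.zero_mem, rfl, rfl, ⟨0, fun _ _ => rfl⟩, fun k =>
        (twist_zero E F k).symm⟩
      smul_mem' := by
        rintro c f ⟨a, ha, h0, h1, ⟨N, hN⟩, h⟩
        refine ⟨c • a, fun k => A.smul_mem c (ha k), by simp [h0], by simp [h1],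
          ⟨N, fun k hk => by simp [hN k hk]⟩, fun k => ?_⟩
        rw [twist_smul, ← h, Pi.smul_apply] }
  have hQ : ∀ f ∈ Q, ∀ m, (∀ k, m < k → f k = 0) → f m ∈ limitSpace E F A := by
    rintro f ⟨a, ha, h0, h1, ⟨N, hN⟩, h⟩ m hm
    rcases m with _ | _ | m
    · rw [h]; simp [twist, h0]
    · rw [h]; simp [twist, h0, h1]
    -- Terms below index `m` may be dropped: coefficients of the twist from index `m + 2` on do not
    -- involve them.
    · refine ⟨fun k => a (k + m), fun k => ha _, ⟨N, fun k hk => hN _ (by omega)⟩,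
        fun k hk => ?_, ?_⟩
      · obtain ⟨k, rfl⟩ := Nat.exists_eq_add_of_le' hk
        have := hm (k + m + 3) (by omega)
        rw [h] at this
        rw [← this]
        simp only [twist, Nat.add_right_comm _ _ m]
      · rw [h]
        simp only [twist, Nat.add_comm _ m, Nat.add_zero, zero_add]
  obtain ⟨hfin, hcard⟩ := card_leading_le (limitSpace E F A) Q hQ (N + 4)
  refine le_trans ?_ hcard
  let ext : (Fin N → A) → ℕ → M := fun b k =>
    if h : 2 ≤ k ∧ k < N + 2 then (b ⟨k - 2, by omega⟩ : M) else 0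
  have hext : ∀ b k, N + 2 ≤ k → ext b k = 0 := fun b k hk =>
    dif_neg fun h => by omega
  let Φ : (Fin N → A) → {f : Q // ∀ k, N + 4 ≤ k → f.1 k = 0} := fun b =>
    ⟨⟨twist E F (ext b), ext b, fun k => by
        simp only [ext]; split_ifs <;> simp, by simp [ext], by simp [ext],
        ⟨N + 2, hext b⟩, fun _ => rfl⟩, fun k hk => by
      obtain ⟨k, rfl⟩ := Nat.exists_eq_add_of_le' (show 2 ≤ k by omega)
      simp [twist, hext b k (by omega), hext b (k + 1) (by omega), hext b (k + 2) (by omega)]⟩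
  have hΦ : Function.Injective Φ := by
    intro b b' hbb
    have h1 : twist E F (ext b) = twist E F (ext b') := congrArg (fun z => z.1.1) hbb
    have h2 : ∀ k, (ext b - ext b') k = 0 :=
      twist_eq_zero (E := E) (F := F) fun k => by rw [twist_sub, h1, sub_self]
    funext i
    have h3 := sub_eq_zero.1 (h2 (i + 2))
    have h4 : 2 ≤ (i : ℕ) + 2 ∧ (i : ℕ) + 2 < N + 2 := ⟨by omega, by omega⟩
    simp only [ext, dif_pos h4] at h3
    exact Subtype.ext h3
  have := Nat.card_le_card_of_injective Φ hΦ
  rwa [Nat.card_fun, Nat.card_fin] at this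

/-- If the polynomial `∑ β (a_t, b_t)` vanishes identically on `A × B`, then the limits of `A` and
`B` annihilate each other. -/
theorem apply_limitSpace_eq_zero {M₁ M₂ M₃ : Type*} [AddCommGroup M₁] [AddCommGroup M₂]
    [AddCommGroup M₃] [Module K M₁] [Module K M₂] [Module K M₃] (β : M₁ →ₗ[K] M₂ →ₗ[K] M₃)
    {E F : M₁ →ₗ[K] M₁} {E' F' : M₂ →ₗ[K] M₂} {A : Submodule K M₁} {B : Submodule K M₂}
    (h0 : ∀ a ∈ A, ∀ b ∈ B, β a b = 0)
    (h1 : ∀ a ∈ A, ∀ b ∈ B, β (E a) b + β a (E' b) = 0)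
    (h2 : ∀ a ∈ A, ∀ b ∈ B, β (F a) b + β (E a) (E' b) + β a (F' b) = 0)
    (h3 : ∀ a ∈ A, ∀ b ∈ B, β (F a) (E' b) + β (E a) (F' b) = 0)
    (h4 : ∀ a ∈ A, ∀ b ∈ B, β (F a) (F' b) = 0)
    {x : M₁} {y : M₂} (hx : x ∈ limitSpace E F A) (hy : y ∈ limitSpace E' F' B) : β x y = 0 := by
  obtain ⟨a, ha, -, hva, rfl⟩ := hx
  obtain ⟨b, hb, -, hvb, rfl⟩ := hy
  -- The right side is the coefficient of `t ^ 4` in the product of the two twisted polynomials; all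
  -- terms but the middle one contain a coefficient beyond the leading one.
  have e : β (twist E F a 2) (twist E' F' b 2) =
      β (twist E F a 0) (twist E' F' b 4) + β (twist E F a 1) (twist E' F' b 3) +
      β (twist E F a 2) (twist E' F' b 2) + β (twist E F a 3) (twist E' F' b 1) +
      β (twist E F a 4) (twist E' F' b 0) := by
    rw [hvb 4 (by norm_num), hvb 3 le_rfl, hva 4 (by norm_num), hva 3 le_rfl]
    simp
  rw [e]
  simp only [twist, map_add, LinearMap.add_apply]
  linear_combination (norm := module) h0 _ (ha 0) _ (hb 4) + h0 _ (ha 1) _ (hb 3) + h0 _ (ha 2) _ (hb 2) +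
    h0 _ (ha 3) _ (hb 1) + h0 _ (ha 4) _ (hb 0) + h1 _ (ha 0) _ (hb 3) + h1 _ (ha 1) _ (hb 2) +
    h1 _ (ha 2) _ (hb 1) + h1 _ (ha 3) _ (hb 0) + h2 _ (ha 0) _ (hb 2) + h2 _ (ha 1) _ (hb 1) +
    h2 _ (ha 2) _ (hb 0) + h3 _ (ha 0) _ (hb 1) + h3 _ (ha 1) _ (hb 0) + h4 _ (ha 0) _ (hb 0)

end Limit

end ProductSubgroups

namespace ProductSubgroups

/-! ### A truncated Baker–Campbell–Hausdorff formula. -/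

section Algebra

theorem one_add_pow_of_sq_eq_zero {R : Type*} [Ring R] {s : R} (hs : s * s = 0) (m : ℕ) :
    (1 + s) ^ m = 1 + m * s := by
  induction m with
  | zero => simp
  | succ m ih =>
    rw [pow_succ, ih]
    push_cast
    linear_combination (norm := noncomm_ring) (m : R) * hs

theorem one_add_mul_one_sub {R : Type*} [Ring R] {s : R} (hs : s * s = 0) :
    (1 + s) * (1 - s) = 1 := by
  linear_combination (norm := noncomm_ring) - hs

theorem map_inv_eq_one_sub {R G : Type*} [Ring R] [Group G] (ρ : G →* R) {g : G} {x : R}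
    (hg : ρ g = 1 + x) (hx : x * x = 0) : ρ g⁻¹ = 1 - x := by
  have h1 : ρ g⁻¹ * ρ g = 1 := by rw [← map_mul, inv_mul_cancel, map_one]
  calc ρ g⁻¹ = ρ g⁻¹ * ((1 + x) * (1 - x)) := by rw [one_add_mul_one_sub hx, mul_one]
    _ = 1 - x := by rw [← mul_assoc, ← hg, h1, one_mul]

open scoped commutatorElement in
theorem map_commutator_eq {R G : Type*} [Ring R] [Group G] (ρ : G →* R) {g h : G} {x y : R}
    (hg : ρ g = 1 + x) (hh : ρ h = 1 + y) (hx : x * x = 0) (hy : y * y = 0)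
    (hxy : x * y * x = 0) (hyx : y * x * y = 0) : ρ ⁅g, h⁆ = 1 + (x * y - y * x) := by
  rw [commutatorElement_def, map_mul, map_mul, map_mul, map_inv_eq_one_sub ρ hg hx,
    map_inv_eq_one_sub ρ hh hy, hg, hh]
  linear_combination (norm := noncomm_ring) - hx - hy + hx * y + hyx - hxy - x * hy + hxy * y

open scoped commutatorElement in
/-- If `ρ g₁ = 1 + x`, `ρ g₂ = 1 + y`, `ρ g₃ = 1 + w` and `q = x + y + w` squares to zero, then
`1 + q` is the image of `g₁ g₂ g₃` times powers of commutators. -/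
theorem exists_map_eq_one_add_add {R G : Type*} [Ring R] [Group G] (ρ : G →* R) {m : ℕ}
    (hm : (2 * m + 1 : R) = 0) (H : Subgroup G) {g₁ g₂ g₃ : G} {x y w : R}
    (h₁ : ρ g₁ = 1 + x) (h₂ : ρ g₂ = 1 + y) (h₃ : ρ g₃ = 1 + w)
    (hH : g₁ * g₂ * g₃ ∈ H) (h₁₂ : ⁅g₁, g₂⁆ ∈ H) (h₁₃ : ⁅g₁, g₃⁆ ∈ H) (h₂₃ : ⁅g₂, g₃⁆ ∈ H)
    (hx : x * x = 0) (hy : y * y = 0) (hw : w * w = 0)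
    (hxyx : x * y * x = 0) (hyxy : y * x * y = 0) (hxwx : x * w * x = 0) (hwxw : w * x * w = 0)
    (hywy : y * w * y = 0) (hwyw : w * y * w = 0) (hq : (x + y + w) * (x + y + w) = 0) :
    ∃ g ∈ H, ρ g = 1 + (x + y + w) := by
  refine ⟨g₁ * g₂ * g₃ * ⁅g₁, g₂⁆ ^ m * ⁅g₁, g₃⁆ ^ m * ⁅g₂, g₃⁆ ^ m,
    H.mul_mem (H.mul_mem (H.mul_mem hH (H.pow_mem h₁₂ m)) (H.pow_mem h₁₃ m)) (H.pow_mem h₂₃ m), ?_⟩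
  have q0 : x * y + y * x + x * w + w * x + y * w + w * y = 0 := by
    linear_combination (norm := noncomm_ring) hq - hx - hy - hw
  -- all products of three different factors agree up to sign
  have xwy : x * w * y = - (x * y * w) := by
    linear_combination (norm := noncomm_ring) x * q0 - hx * y - hxyx - hx * w - hxwx
  have wyx : w * y * x = - (y * w * x) := by
    linear_combination (norm := noncomm_ring) q0 * x - hxyx - y * hx - hxwx - w * hx
  have ywx : y * w * x = - (y * x * w) := by
    linear_combination (norm := noncomm_ring) y * q0 - hyxy - hy * x - hy * w - hywy
  have wxy : w * x * y = - (x * w * y) := by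
    linear_combination (norm := noncomm_ring) q0 * y - x * hy - hyxy - hywy - w * hy
  have yxw : y * x * w = - (x * y * w) := by
    linear_combination (norm := noncomm_ring) q0 * w - x * hw - hwxw - y * hw - hwyw
  have sq : ∀ a b : R, a * a = 0 → b * b = 0 → a * b * a = 0 → b * a * b = 0 →
      (a * b - b * a) * (a * b - b * a) = 0 := by
    intro a b ha hb hab hba
    linear_combination (norm := noncomm_ring) hab * b - a * hb * a - b * ha * b + hba * a
  rw [map_mul, map_mul, map_mul, map_mul, map_mul, map_pow, map_pow, map_pow,
    map_commutator_eq ρ h₁ h₂ hx hy hxyx hyxy, map_commutator_eq ρ h₁ h₃ hx hw hxwx hwxw,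
    map_commutator_eq ρ h₂ h₃ hy hw hywy hwyw,
    one_add_pow_of_sq_eq_zero (sq x y hx hy hxyx hyxy),
    one_add_pow_of_sq_eq_zero (sq x w hx hw hxwx hwxw),
    one_add_pow_of_sq_eq_zero (sq y w hy hw hywy hwyw), h₁, h₂, h₃]
  generalize hs₁ : x * y - y * x = s₁
  generalize hs₂ : x * w - w * x = s₂
  generalize hs₃ : y * w - w * y = s₃
  -- Since `m = -1/2`, the powers of commutators remove the half commutators here.
  have e1 : (1 + x) * (1 + y) * (1 + w) =
      1 + (x + y + w) - m * (s₁ + s₂ + s₃) + x * y * w := by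
    subst hs₁ hs₂ hs₃
    have h2 : (1 + x) * (1 + y) * (1 + w) = 1 + (x + y + w) +
      (2 * m + 1) * (x * y + x * w + y * w) - 2 * m * (x * y + x * w + y * w) + x * y * w := by
      noncomm_ring
    rw [h2, hm, zero_mul, add_zero]
    have h3 : (m : R) * (x * y + y * x + x * w + w * x + y * w + w * y) = 0 := by
      rw [q0, mul_zero]
    linear_combination (norm := noncomm_ring) - h3
  have xs₁ : x * s₁ = 0 := by
    subst hs₁; linear_combination (norm := noncomm_ring) hx * y - hxyx
  have ys₁ : y * s₁ = 0 := by
    subst hs₁; linear_combination (norm := noncomm_ring) hyxy - hy * x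
  have xs₂ : x * s₂ = 0 := by
    subst hs₂; linear_combination (norm := noncomm_ring) hx * w - hxwx
  have ws₂ : w * s₂ = 0 := by
    subst hs₂; linear_combination (norm := noncomm_ring) hwxw - hw * x
  have ys₃ : y * s₃ = 0 := by
    subst hs₃; linear_combination (norm := noncomm_ring) hy * w - hywy
  have ws₃ : w * s₃ = 0 := by
    subst hs₃; linear_combination (norm := noncomm_ring) hwyw - hw * y
  have ws₁ : w * s₁ = 2 * (x * y * w) := by
    subst hs₁
    have : w * (x * y - y * x) = w * x * y - w * y * x := by noncomm_ring
    rw [this, wxy, wyx, xwy, ywx, yxw]; noncomm_ring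
  have ys₂ : y * s₂ = - 2 * (x * y * w) := by
    subst hs₂
    have : y * (x * w - w * x) = y * x * w - y * w * x := by noncomm_ring
    rw [this, ywx, yxw]; noncomm_ring
  have xs₃ : x * s₃ = 2 * (x * y * w) := by
    subst hs₃
    have : x * (y * w - w * y) = x * y * w - x * w * y := by noncomm_ring
    rw [this, xwy]; noncomm_ring
  have hc : ∀ r : R, r * m = m * r := fun r => ((Nat.cast_commute m r).eq).symm
  have xt : x * (x * y * w) = 0 := by linear_combination (norm := noncomm_ring) hx * y * w
  have yt : y * (x * y * w) = 0 := by linear_combination (norm := noncomm_ring) hyxy * w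
  have wt : w * (x * y * w) = 0 := by
    have : w * (x * y * w) = w * x * y * w := by noncomm_ring
    rw [this, wxy]
    linear_combination (norm := noncomm_ring) - x * hwyw
  have ts₁ : x * y * w * s₁ = 0 := by
    linear_combination (norm := noncomm_ring) x * y * ws₁ + 2 * (x * yt)
  have ts₃ : x * y * w * s₃ = 0 := by
    linear_combination (norm := noncomm_ring) x * y * ws₃
  generalize x * y * w = t at *
  have qs₁ : (x + y + w) * s₁ = 2 * t := by
    linear_combination (norm := noncomm_ring) xs₁ + ys₁ + ws₁
  have qs₂ : (x + y + w) * s₂ = - 2 * t := by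
    linear_combination (norm := noncomm_ring) xs₂ + ys₂ + ws₂
  have qs₃ : (x + y + w) * s₃ = 2 * t := by
    linear_combination (norm := noncomm_ring) xs₃ + ys₃ + ws₃
  have s₁_mul : ∀ r, s₁ * r = x * (y * r) - y * (x * r) := fun r => by
    rw [← hs₁]; noncomm_ring
  have s₂_mul : ∀ r, s₂ * r = x * (w * r) - w * (x * r) := fun r => by
    rw [← hs₂]; noncomm_ring
  have s₃_mul : ∀ r, s₃ * r = y * (w * r) - w * (y * r) := fun r => by
    rw [← hs₃]; noncomm_ring
  have two_t : ∀ r : R, r * (2 * t) = 2 * (r * t) := fun r => by noncomm_ring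
  have s₁₁ : s₁ * s₁ = 0 := by rw [s₁_mul, xs₁, ys₁]; simp
  have s₂₁ : s₂ * s₁ = 0 := by rw [s₂_mul, xs₁, ws₁, two_t, xt]; simp
  have s₃₁ : s₃ * s₁ = 0 := by rw [s₃_mul, ys₁, ws₁, two_t, yt]; simp
  have s₂₂ : s₂ * s₂ = 0 := by rw [s₂_mul, xs₂, ws₂]; simp
  have s₃₂ : s₃ * s₂ = 0 := by rw [s₃_mul, ws₂, ys₂, neg_mul, mul_neg, two_t, wt]; simp
  have s₃₃ : s₃ * s₃ = 0 := by rw [s₃_mul, ys₃, ws₃]; simp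
  generalize x + y + w = q at *
  -- The cubic term `t` disappears, reappears and disappears again in the three multiplications,
  -- because `m * (2 * t) = -t`.
  have f₁ : (1 + q - m * (s₁ + s₂ + s₃) + t) * (1 + m * s₁) = 1 + q - m * (s₂ + s₃) := by
    linear_combination (norm := noncomm_ring) hm * t + m * qs₁ + hc q * s₁ + hc t * s₁ + m * ts₁
      - m * hc (s₁ + s₂ + s₃) * s₁ - m * m * (s₁₁ + s₂₁ + s₃₁)
  have f₂ : (1 + q - m * (s₂ + s₃)) * (1 + m * s₂) = 1 + q - m * s₃ + t := by
    linear_combination (norm := noncomm_ring) - hm * t + m * qs₂ + hc q * s₂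
      - m * hc (s₂ + s₃) * s₂ - m * m * (s₂₂ + s₃₂)
  have f₃ : (1 + q - m * s₃ + t) * (1 + m * s₃) = 1 + q := by
    linear_combination (norm := noncomm_ring) hm * t + m * qs₃ + hc q * s₃ + hc t * s₃ + m * ts₃
      - m * hc s₃ * s₃ - m * m * s₃₃
  rw [e1, f₁, f₂, f₃]

end Algebra

end ProductSubgroups

namespace ProductSubgroups

/-! ### Maximal pairs and Thompson replacement. -/

section Pairs

open scoped commutatorElement

/-- Lagrange interpolation at `0, …, 4`, with denominators 12 and 24 cleared. -/
theorem coeff_eq_zero_of_quartic {K M : Type*} [Field K] [AddCommGroup M] [Module K M]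
    (h2 : (2 : K) ≠ 0) (h3 : (3 : K) ≠ 0) {c₀ c₁ c₂ c₃ c₄ : M}
    (h : ∀ k : ℕ, c₀ + (k : K) • c₁ + (k : K) ^ 2 • c₂ + (k : K) ^ 3 • c₃ + (k : K) ^ 4 • c₄ = 0) :
    c₁ = 0 ∧ c₂ = 0 ∧ c₃ = 0 ∧ c₄ = 0 := by
  have f0 := h 0
  have f1 := h 1
  have f2 := h 2
  have f3 := h 3
  have f4 := h 4
  push_cast at f0 f1 f2 f3 f4
  have h12 : (12 : K) ≠ 0 := by
    rw [show (12 : K) = 2 * 2 * 3 by norm_num]; exact mul_ne_zero (mul_ne_zero h2 h2) h3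
  have h24 : (24 : K) ≠ 0 := by
    rw [show (24 : K) = 2 * 12 by norm_num]; exact mul_ne_zero h2 h12
  refine ⟨(smul_eq_zero_iff_right h12).1 ?_, (smul_eq_zero_iff_right h24).1 ?_,
    (smul_eq_zero_iff_right h12).1 ?_, (smul_eq_zero_iff_right h24).1 ?_⟩
  · linear_combination (norm := module) (-25 : K) • f0 + (48 : K) • f1 - (36 : K) • f2 +
      (16 : K) • f3 - (3 : K) • f4
  · linear_combination (norm := module) (35 : K) • f0 - (104 : K) • f1 + (114 : K) • f2 -
      (56 : K) • f3 + (11 : K) • f4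
  · linear_combination (norm := module) (-5 : K) • f0 + (18 : K) • f1 - (24 : K) • f2 +
      (14 : K) • f3 - (3 : K) • f4
  · linear_combination (norm := module) f0 - (4 : K) • f1 + (6 : K) • f2 - (4 : K) • f3 + f4

variable {K W G : Type*} [Field K] [AddCommGroup W] [Module K W] [Group G]

/-- The traces on `W` and `G` of a central series of `W ⋊ G` that has `W` among its terms. -/
structure IsCentralPairSeries (ρ : G →* Module.End K W) (n : ℕ) (Y : ℕ → Submodule K W)
    (Z : ℕ → Subgroup G) : Prop where
  left_zero : Y 0 = ⊥
  right_zero : Z 0 = ⊥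
  left_last : Y n = ⊤
  right_last : Z n = ⊤
  left_le : ∀ i < n, Y i ≤ Y (i + 1)
  right_le : ∀ i < n, Z i ≤ Z (i + 1)
  left_sub_mem : ∀ i < n, ∀ v ∈ Y (i + 1), ∀ g, ρ g v - v ∈ Y i
  right_commutator_mem : ∀ i < n, ∀ z ∈ Z (i + 1), ∀ g, ⁅z, g⁆ ∈ Z i
  left_top_or : ∀ i ≤ n, Y i = ⊤ ∨ Z i = ⊥
  exists_split : ∃ j ≤ n, Y j = ⊤ ∧ Z j = ⊥

theorem IsCentralPairSeries.map_mem {ρ : G →* Module.End K W} {n : ℕ} {Y : ℕ → Submodule K W}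
    {Z : ℕ → Subgroup G} (h : IsCentralPairSeries ρ n Y Z) {i : ℕ} (hi : i ≤ n) {v : W}
    (hv : v ∈ Y i) (g : G) : ρ g v ∈ Y i := by
  rcases i with _ | i
  · rw [h.left_zero, Submodule.mem_bot] at hv ⊢
    rw [hv, map_zero]
  · have := (Y (i + 1)).add_mem (h.left_le i hi (h.left_sub_mem i hi v hv g)) hv
    rwa [sub_add_cancel] at this

theorem IsCentralPairSeries.conj_mem {ρ : G →* Module.End K W} {n : ℕ} {Y : ℕ → Submodule K W}
    {Z : ℕ → Subgroup G} (h : IsCentralPairSeries ρ n Y Z) {i : ℕ} (hi : i ≤ n) {z : G}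
    (hz : z ∈ Z i) (g : G) : g * z * g⁻¹ ∈ Z i := by
  rcases i with _ | i
  · rw [h.right_zero, Subgroup.mem_bot] at hz ⊢
    simp [hz]
  · have h1 := h.right_le i hi (h.right_commutator_mem i hi z hz g)
    have h2 := (Z (i + 1)).mul_mem ((Z (i + 1)).inv_mem h1) hz
    rwa [commutatorElement_inv, commutatorElement_def, inv_mul_cancel_right] at h2

/-- `H` is abelian and centralizes `U`. -/
def IsAbelianPair (ρ : G →* Module.End K W) (U : Submodule K W) (H : Subgroup G) : Prop :=
  (∀ a ∈ H, ∀ b ∈ H, a * b = b * a) ∧ ∀ a ∈ H, ∀ u ∈ U, ρ a u = u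

/-- `U ⋊ A` is an abelian subgroup of maximum order, not contained in `W`, and maximal with respect
to the series. -/
structure IsMaximalPair (ρ : G →* Module.End K W) (n : ℕ) (Y : ℕ → Submodule K W)
    (Z : ℕ → Subgroup G) (U : Submodule K W) (A : Subgroup G) : Prop where
  isAbelianPair : IsAbelianPair ρ U A
  ne_bot : A ≠ ⊥
  card_le : ∀ U' H, IsAbelianPair ρ U' H → Nat.card U' * Nat.card H ≤ Nat.card U * Nat.card A
  card_eq : ∀ U' H, IsAbelianPair ρ U' H → H ≠ ⊥ →
    (∀ i ≤ n, Nat.card ↥(U ⊓ Y i) * Nat.card ↥(A ⊓ Z i) ≤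
      Nat.card ↥(U' ⊓ Y i) * Nat.card ↥(H ⊓ Z i)) →
    ∀ i ≤ n, Nat.card ↥(U ⊓ Y i) * Nat.card ↥(A ⊓ Z i) =
      Nat.card ↥(U' ⊓ Y i) * Nat.card ↥(H ⊓ Z i)

variable {ρ : G →* Module.End K W} {n : ℕ} {Y : ℕ → Submodule K W}
    {Z : ℕ → Subgroup G} {U : Submodule K W} {A : Subgroup G}

theorem submodule_eq_of_le_of_card_le [Finite W] {U U' : Submodule K W} (h : U ≤ U')
    (hc : Nat.card U' ≤ Nat.card U) : U = U' :=
  SetLike.coe_injective (Set.eq_of_subset_of_ncard_le h hc (Set.toFinite _))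

theorem subgroup_eq_of_le_of_card_le [Finite G] {U U' : Subgroup G} (h : U ≤ U')
    (hc : Nat.card U' ≤ Nat.card U) : U = U' :=
  SetLike.coe_injective (Set.eq_of_subset_of_ncard_le h hc (Set.toFinite _))

theorem card_submodule_le [Finite W] {U U' : Submodule K W} (h : U ≤ U') :
    Nat.card U ≤ Nat.card U' :=
  Nat.card_mono (Set.toFinite _) h

theorem card_subgroup_le [Finite G] {U U' : Subgroup G} (h : U ≤ U') :
    Nat.card U ≤ Nat.card U' :=
  Nat.card_mono (Set.toFinite _) h

/-- Maximal order forces `U` to be the full fixed space of `A`. -/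
theorem IsMaximalPair.mem_of_fixed [Finite W] [Finite G] (h : IsMaximalPair ρ n Y Z U A) {v : W}
    (hv : ∀ a ∈ A, ρ a v = v) : v ∈ U := by
  let U' : Submodule K W :=
    { carrier := {v | ∀ a ∈ A, ρ a v = v}
      add_mem' := fun hx hy a ha => by rw [map_add, hx a ha, hy a ha]
      zero_mem' := fun a _ => map_zero _
      smul_mem' := fun c x hx a ha => by rw [map_smul, hx a ha] }
  have hU : U ≤ U' := fun u hu a ha => h.isAbelianPair.2 a ha u hu
  have := h.card_le U' A ⟨h.isAbelianPair.1, fun a ha u hu => hu a ha⟩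
  rw [submodule_eq_of_le_of_card_le hU (Nat.le_of_mul_le_mul_right this Nat.card_pos)]
  exact hv

/-- Thompson replacement. -/
theorem IsMaximalPair.map_sub_mem_of_triple {p : ℕ} {W G : Type*} [Fact p.Prime] [AddCommGroup W]
    [Module (ZMod p) W] [Finite W] [Group G] [Finite G] {ρ : G →* Module.End (ZMod p) W} {n : ℕ}
    {Y : ℕ → Submodule (ZMod p) W} {Z : ℕ → Subgroup G} {U : Submodule (ZMod p) W}
    {A : Subgroup G} (hZ : IsCentralPairSeries ρ n Y Z) (h : IsMaximalPair ρ n Y Z U A) {v : W}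
    (hv : ∀ a ∈ A, ∀ b ∈ A, (ρ a - 1) ((ρ b - 1) v) ∈ U) : ∀ a ∈ A, (ρ a - 1) v ∈ U := by
  obtain ⟨hcomm, hfix⟩ := h.isAbelianPair
  have hswap : ∀ a ∈ A, ∀ b ∈ A, ∀ w, (ρ a - 1) ((ρ b - 1) w) = (ρ b - 1) ((ρ a - 1) w) := by
    intro a ha b hb w
    have : ρ a (ρ b w) = ρ b (ρ a w) := by
      rw [← Module.End.mul_apply, ← map_mul, hcomm a ha b hb, map_mul, Module.End.mul_apply]
    simp only [LinearMap.sub_apply, Module.End.one_apply, map_sub, this]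
    abel
  have hzero : ∀ a ∈ A, ∀ u ∈ U, (ρ a - 1) u = 0 := fun a ha u hu => by
    simp [hfix a ha u hu]
  have hmul : ∀ a ∈ A, ∀ b ∈ A, (ρ (a * b) - 1) v - ((ρ a - 1) v + (ρ b - 1) v) ∈ U := by
    intro a ha b hb
    convert hv a ha b hb using 1
    simp only [LinearMap.sub_apply, Module.End.one_apply, map_sub, map_mul, Module.End.mul_apply]
    abel
  have hinv : ∀ a ∈ A, (ρ a⁻¹ - 1) v + (ρ a - 1) v ∈ U := by
    intro a ha
    have := hmul a⁻¹ (A.inv_mem ha) a ha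
    rw [inv_mul_cancel, map_one, sub_self, LinearMap.zero_apply, zero_sub] at this
    simpa using U.neg_mem this
  -- The replacement pair is `U' = U + [v, A]` and `E = {e ∈ A | [v, e] ∈ U}`.
  let U₀ : AddSubgroup W :=
    { carrier := {x | ∃ a ∈ A, x - (ρ a - 1) v ∈ U}
      add_mem' := by
        rintro x y ⟨a, ha, hx⟩ ⟨b, hb, hy⟩
        refine ⟨a * b, A.mul_mem ha hb, ?_⟩
        convert U.sub_mem (U.add_mem hx hy) (hmul a ha b hb) using 1
        abel
      zero_mem' := ⟨1, A.one_mem, by simp⟩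
      neg_mem' := by
        rintro x ⟨a, ha, hx⟩
        refine ⟨a⁻¹, A.inv_mem ha, ?_⟩
        convert U.sub_mem (U.neg_mem hx) (hinv a ha) using 1
        abel }
  let U' : Submodule (ZMod p) W := AddSubgroup.toZModSubmodule p U₀
  have memU' : ∀ x, x ∈ U' ↔ ∃ a ∈ A, x - (ρ a - 1) v ∈ U := fun x => Iff.rfl
  let E : Subgroup G :=
    { carrier := {e | e ∈ A ∧ (ρ e - 1) v ∈ U}
      mul_mem' := by
        rintro a b ⟨ha, ha'⟩ ⟨hb, hb'⟩
        refine ⟨A.mul_mem ha hb, ?_⟩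
        simpa using U.add_mem (hmul a ha b hb) (U.add_mem ha' hb')
      one_mem' := ⟨A.one_mem, by simp⟩
      inv_mem' := by
        rintro a ⟨ha, ha'⟩
        refine ⟨A.inv_mem ha, ?_⟩
        simpa using U.sub_mem (hinv a ha) ha' }
  have hUU' : U ≤ U' := fun u hu => (memU' u).2 ⟨1, A.one_mem, by simpa using hu⟩
  have hpair : IsAbelianPair ρ U' E := by
    refine ⟨fun a ha b hb => hcomm a ha.1 b hb.1, fun e he x hx => ?_⟩
    obtain ⟨a, ha, hx⟩ := (memU' x).1 hx
    have h1 := hzero e he.1 _ hx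
    have h2 : (ρ e - 1) ((ρ a - 1) v) = 0 := by
      rw [hswap e he.1 a ha, hzero a ha _ he.2]
    rw [map_sub, h2, sub_zero] at h1
    exact sub_eq_zero.1 h1
  -- Two elements in one fibre of `(u, a) ↦ u + [v, a]` have second components that differ by an
  -- element of `E`, and these determine the first components.
  have hcount : ∀ B : Subgroup G, Nat.card U * Nat.card ↥(A ⊓ B) ≤
      Nat.card U' * Nat.card ↥(E ⊓ B) := by
    intro B
    rw [← Nat.card_prod]
    let f : U × ↥(A ⊓ B) → U' := fun x =>
      ⟨x.1 + (ρ x.2.1 - 1) v, (memU' _).2 ⟨x.2.1, x.2.2.1, by simp⟩⟩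
    refine card_le_card_mul_of_fiber f _ fun x => ?_
    have key : ∀ y : {y // f y = f x}, y.1.2.1 * x.2.1⁻¹ ∈ E ⊓ B := by
      rintro ⟨y, hy⟩
      refine ⟨⟨A.mul_mem y.2.2.1 (A.inv_mem x.2.2.1), ?_⟩,
        B.mul_mem y.2.2.2 (B.inv_mem x.2.2.2)⟩
      have h1 : (y.1 : W) + (ρ y.2.1 - 1) v = x.1 + (ρ x.2.1 - 1) v := congrArg Subtype.val hy
      have h2 := hmul y.2.1 y.2.2.1 x.2.1⁻¹ (A.inv_mem x.2.2.1)
      have h3 := hinv x.2.1 x.2.2.1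
      have h4 : (ρ y.2.1 - 1) v = x.1 + (ρ x.2.1 - 1) v - y.1 := by rw [← h1]; abel
      rw [h4] at h2
      convert U.add_mem (U.add_mem h2 h3) (U.sub_mem x.1.2 y.1.2) using 1
      abel
    refine Nat.card_le_card_of_injective (fun y => (⟨_, key y⟩ : ↥(E ⊓ B))) ?_
    intro y z hyz
    have h1 : y.1.2.1 = z.1.2.1 := mul_right_cancel (congrArg Subtype.val hyz)
    have h2 : (y.1.1 : W) + (ρ y.1.2.1 - 1) v = z.1.1 + (ρ z.1.2.1 - 1) v :=
      congrArg Subtype.val (y.2.trans z.2.symm)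
    rw [h1] at h2
    exact Subtype.ext (Prod.ext (Subtype.ext (add_right_cancel h2)) (Subtype.ext h1))
  intro a ha
  -- If `E` is trivial, the replacement lies in `W` and is no admissible competitor. Then `U'` is
  -- all of `W`, so `v ∈ U + [v, A]`, which suffices.
  by_cases hE : E = ⊥
  · have h1 := h.card_le ⊤ ⊥ ⟨by simp, by simp⟩
    have h2 := hcount ⊤
    rw [inf_top_eq, inf_top_eq, hE] at h2
    have h3 : U' = ⊤ := submodule_eq_of_le_of_card_le le_top
      (Nat.le_of_mul_le_mul_right (h1.trans h2) Nat.card_pos)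
    refine h.mem_of_fixed fun b hb => ?_
    obtain ⟨c, hc, hcU⟩ := (memU' _).1 (h3.ge (Submodule.mem_top (x := v)))
    have h4 := hzero b hb _ (hv a ha c hc)
    have h5 := hzero a ha _ hcU
    rw [map_sub, sub_eq_zero] at h5
    rw [← h5] at h4
    exact sub_eq_zero.1 h4
  · obtain ⟨j, hj, hYj, hZj⟩ := hZ.exists_split
    have h1 := h.card_eq U' E hpair hE (fun i hi => ?_) j hj
    · rw [hYj, hZj, inf_top_eq, inf_top_eq, inf_bot_eq, inf_bot_eq] at h1
      rw [submodule_eq_of_le_of_card_le hUU' (Nat.eq_of_mul_eq_mul_right Nat.card_pos h1).ge]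
      exact (memU' _).2 ⟨a, ha, by simp⟩
    · rcases hZ.left_top_or i hi with hY | hY
      · rw [hY, inf_top_eq, inf_top_eq]
        exact hcount _
      · rw [hY, inf_bot_eq, inf_bot_eq]
        exact Nat.mul_le_mul_right _ (card_submodule_le (inf_le_inf_right _ hUU'))

/-- The group `A` of a maximal pair acts quadratically. -/
theorem IsMaximalPair.quadratic {p : ℕ} {W G : Type*} [Fact p.Prime] [AddCommGroup W]
    [Module (ZMod p) W] [Finite W] [Group G] [Finite G] {ρ : G →* Module.End (ZMod p) W} {n : ℕ}
    {Y : ℕ → Submodule (ZMod p) W} {Z : ℕ → Subgroup G} {U : Submodule (ZMod p) W}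
    {A : Subgroup G} (hZ : IsCentralPairSeries ρ n Y Z) (h : IsMaximalPair ρ n Y Z U A) :
    ∀ a ∈ A, ∀ v, (ρ a - 1) v ∈ U := by
  -- For `v ∈ Y (i + 1)` the vectors `[v, b]` lie in `Y i`, so induction gives `[v, A, A] ≤ U`, as
  -- replacement requires.
  have key : ∀ i ≤ n, ∀ v ∈ Y i, ∀ a ∈ A, (ρ a - 1) v ∈ U := by
    intro i
    induction i with
    | zero =>
      intro _ v hv a _
      rw [hZ.left_zero, Submodule.mem_bot] at hv
      simp [hv]
    | succ i ih =>
      intro hi v hv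
      refine h.map_sub_mem_of_triple hZ fun a ha b _ => ?_
      exact ih (by omega) _ (hZ.left_sub_mem i hi v hv b) a ha
  intro a ha v
  exact key n le_rfl v (by rw [hZ.left_last]; trivial) a ha

theorem IsMaximalPair.sub_one_mul_sub_one (h : IsMaximalPair ρ n Y Z U A)
    (hq : ∀ a ∈ A, ∀ v, (ρ a - 1) v ∈ U) {a b : G} (ha : a ∈ A) (hb : b ∈ A) :
    (ρ a - 1) * (ρ b - 1) = 0 := by
  ext v
  rw [Module.End.mul_apply]
  exact sub_eq_zero.2 (h.isAbelianPair.2 a ha _ (hq b hb v))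

end Pairs

end ProductSubgroups

namespace ProductSubgroups

/-! ### Powers of unipotent maps of degree 3. -/

section Unipotent

variable {K M : Type*} [Field K] [AddCommGroup M] [Module K M]

/-- The linear term of `t ↦ T ^ t`, when `(T - 1) ^ 3 = 0`. -/
def linTerm (T : Module.End K M) : Module.End K M := (T - 1) - (2⁻¹ : K) • ((T - 1) * (T - 1))

/-- The quadratic term of `t ↦ T ^ t`, when `(T - 1) ^ 3 = 0`. -/
def quadTerm (T : Module.End K M) : Module.End K M := (2⁻¹ : K) • ((T - 1) * (T - 1))

theorem linTerm_add_quadTerm (T : Module.End K M) (x : M) :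
    linTerm T x + quadTerm T x = (T - 1) x := by
  simp [linTerm, quadTerm]

theorem two_smul_quadTerm (h2 : (2 : K) ≠ 0) (T : Module.End K M) (x : M) :
    (2 : K) • quadTerm T x = (T - 1) ((T - 1) x) := by
  rw [quadTerm, LinearMap.smul_apply, smul_smul, mul_inv_cancel₀ h2, one_smul, Module.End.mul_apply]

theorem linTerm_mem {T : Module.End K M} {B : Submodule K M} {x : M} (h1 : (T - 1) x ∈ B)
    (h2 : (T - 1) ((T - 1) x) ∈ B) : linTerm T x ∈ B := by
  rw [linTerm, LinearMap.sub_apply, LinearMap.smul_apply, Module.End.mul_apply]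
  exact B.sub_mem h1 (B.smul_mem _ h2)

theorem quadTerm_mem {T : Module.End K M} {B : Submodule K M} {x : M}
    (h2 : (T - 1) ((T - 1) x) ∈ B) : quadTerm T x ∈ B := by
  rw [quadTerm, LinearMap.smul_apply, Module.End.mul_apply]
  exact B.smul_mem _ h2

theorem sub_one_quadTerm {T : Module.End K M} {x : M} (h : (T - 1) ((T - 1) ((T - 1) x)) = 0) :
    (T - 1) (quadTerm T x) = 0 := by
  rw [quadTerm, LinearMap.smul_apply, Module.End.mul_apply, map_smul, h, smul_zero]

theorem linTerm_quadTerm {T : Module.End K M} {x : M} (h : (T - 1) ((T - 1) ((T - 1) x)) = 0) :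
    linTerm T (quadTerm T x) = 0 := by
  rw [linTerm, LinearMap.sub_apply, LinearMap.smul_apply, Module.End.mul_apply,
    sub_one_quadTerm h, map_zero, smul_zero, sub_zero]

theorem quadTerm_quadTerm {T : Module.End K M} {x : M} (h : (T - 1) ((T - 1) ((T - 1) x)) = 0) :
    quadTerm T (quadTerm T x) = 0 := by
  nth_rw 1 [quadTerm]
  rw [LinearMap.smul_apply, Module.End.mul_apply, sub_one_quadTerm h, map_zero, smul_zero]

theorem sub_one_linTerm (h2 : (2 : K) ≠ 0) {T : Module.End K M} {x : M}
    (h : (T - 1) ((T - 1) ((T - 1) x)) = 0) :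
    (T - 1) (linTerm T x) = (2 : K) • quadTerm T x := by
  have e : linTerm T x = (T - 1) x - (2⁻¹ : K) • (T - 1) ((T - 1) x) := rfl
  rw [two_smul_quadTerm h2, e, map_sub, map_smul, h, smul_zero, sub_zero]

/-- This is the binomial expansion `1 + k (T - 1) + (k (k - 1) / 2) (T - 1) ^ 2`, sorted by powers
of `k`. -/
theorem pow_apply_eq (h2 : (2 : K) ≠ 0) {T : Module.End K M} {x : M}
    (h : (T - 1) ((T - 1) ((T - 1) x)) = 0) (k : ℕ) :
    (T ^ k) x = x + (k : K) • linTerm T x + (k : K) ^ 2 • quadTerm T x := by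
  induction k with
  | zero => simp
  | succ k ih =>
    have hT : ∀ y, T y = y + (T - 1) y := fun y => by simp
    rw [pow_succ', Module.End.mul_apply, ih, hT]
    simp only [map_add, map_smul, sub_one_quadTerm h, sub_one_linTerm h2 h]
    rw [← linTerm_add_quadTerm]
    push_cast
    module

/-- The values at natural powers form a quartic polynomial in `k`; when 2 and 3 are invertible its
vanishing at `0, …, 4` yields all the coefficient identities. -/
theorem apply_limitSpace_eq_zero_of_pow {M₁ M₂ M₃ : Type*} [AddCommGroup M₁] [AddCommGroup M₂]
    [AddCommGroup M₃] [Module K M₁] [Module K M₂] [Module K M₃] (h2 : (2 : K) ≠ 0)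
    (h3 : (3 : K) ≠ 0) (β : M₁ →ₗ[K] M₂ →ₗ[K] M₃)
    {T : Module.End K M₁} {T' : Module.End K M₂} {A : Submodule K M₁} {B : Submodule K M₂}
    (hA : ∀ a ∈ A, (T - 1) ((T - 1) ((T - 1) a)) = 0)
    (hB : ∀ b ∈ B, (T' - 1) ((T' - 1) ((T' - 1) b)) = 0)
    (h : ∀ a ∈ A, ∀ b ∈ B, ∀ k : ℕ, β ((T ^ k) a) ((T' ^ k) b) = 0) {x : M₁} {y : M₂}
    (hx : x ∈ limitSpace (linTerm T) (quadTerm T) A)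
    (hy : y ∈ limitSpace (linTerm T') (quadTerm T') B) : β x y = 0 := by
  have key := fun a ha b hb => coeff_eq_zero_of_quartic h2 h3 (c₀ := β a b)
    (c₁ := β (linTerm T a) b + β a (linTerm T' b))
    (c₂ := β (quadTerm T a) b + β (linTerm T a) (linTerm T' b) + β a (quadTerm T' b))
    (c₃ := β (quadTerm T a) (linTerm T' b) + β (linTerm T a) (quadTerm T' b))
    (c₄ := β (quadTerm T a) (quadTerm T' b)) (fun k => by
      rw [← h a ha b hb k, pow_apply_eq h2 (hA a ha), pow_apply_eq h2 (hB b hb)]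
      simp only [map_add, map_smul, LinearMap.add_apply, LinearMap.smul_apply]
      module)
  refine apply_limitSpace_eq_zero β (fun a ha b hb => ?_) (fun a ha b hb => (key a ha b hb).1)
    (fun a ha b hb => (key a ha b hb).2.1) (fun a ha b hb => (key a ha b hb).2.2.1)
    (fun a ha b hb => (key a ha b hb).2.2.2) hx hy
  simpa using h a ha b hb 0

end Unipotent

/-! ### The action of `G` on endomorphisms. -/

section Conjugation

variable {K W G : Type*} [Field K] [AddCommGroup W] [Module K W] [Group G]

/-- Conjugation by `ρ h` on the endomorphisms of `W`. -/
def conjEnd (ρ : G →* Module.End K W) (h : G) : Module.End K (Module.End K W) :=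
  LinearMap.mulLeft K (ρ h) ∘ₗ LinearMap.mulRight K (ρ h⁻¹)

theorem conjEnd_apply (ρ : G →* Module.End K W) (h : G) (x : Module.End K W) :
    conjEnd ρ h x = ρ h * x * ρ h⁻¹ := by
  simp [conjEnd, mul_assoc]

theorem map_inv_mul_map (ρ : G →* Module.End K W) (h : G) : ρ h⁻¹ * ρ h = 1 := by
  rw [← map_mul, inv_mul_cancel, map_one]

theorem map_mul_map_inv (ρ : G →* Module.End K W) (h : G) : ρ h * ρ h⁻¹ = 1 := by
  rw [← map_mul, mul_inv_cancel, map_one]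

theorem conjEnd_mul (ρ : G →* Module.End K W) (h : G) (x y : Module.End K W) :
    conjEnd ρ h (x * y) = conjEnd ρ h x * conjEnd ρ h y := by
  simp only [conjEnd_apply]
  calc ρ h * (x * y) * ρ h⁻¹ = ρ h * x * (1 * (y * ρ h⁻¹)) := by simp only [one_mul, mul_assoc]
    _ = _ := by rw [← map_inv_mul_map ρ h]; simp only [mul_assoc]

theorem conjEnd_map_sub_one (ρ : G →* Module.End K W) (h a : G) :
    conjEnd ρ h (ρ a - 1) = ρ (h * a * h⁻¹) - 1 := by
  rw [conjEnd_apply, map_mul, map_mul, mul_sub, sub_mul, mul_one, map_mul_map_inv]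

theorem conjEnd_pow_mul (ρ : G →* Module.End K W) (h : G) (x y : Module.End K W) (k : ℕ) :
    (conjEnd ρ h ^ k) (x * y) = (conjEnd ρ h ^ k) x * (conjEnd ρ h ^ k) y := by
  induction k with
  | zero => simp
  | succ k ih => simp only [pow_succ', Module.End.mul_apply, ih, conjEnd_mul]

theorem conjEnd_pow_apply (ρ : G →* Module.End K W) (h : G) (x : Module.End K W) (v : W) (k : ℕ) :
    (conjEnd ρ h ^ k) x ((ρ h ^ k) v) = (ρ h ^ k) (x v) := by
  induction k with
  | zero => simp
  | succ k ih =>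
    rw [pow_succ', pow_succ', Module.End.mul_apply, conjEnd_apply, Module.End.mul_apply,
      Module.End.mul_apply, Module.End.mul_apply]
    have : ρ h⁻¹ (ρ h ((ρ h ^ k) v)) = (ρ h ^ k) v := by
      rw [← Module.End.mul_apply (ρ h⁻¹), map_inv_mul_map, Module.End.one_apply]
    rw [this, ih, Module.End.mul_apply]

/-- `ρ (hⁱ a h⁻ⁱ) - 1`. -/
def conjLog (ρ : G →* Module.End K W) (h : G) (i : ℤ) (a : G) : Module.End K W :=
  ρ (h ^ i * a * h ^ (-i)) - 1

theorem map_conj_eq (ρ : G →* Module.End K W) (h : G) (i : ℤ) (a : G) :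
    ρ (h ^ i * a * h ^ (-i)) = 1 + conjLog ρ h i a := by
  rw [conjLog, add_sub_cancel]

theorem conjLog_eq_conjEnd (ρ : G →* Module.End K W) (h : G) (i j : ℤ) (a : G) :
    conjLog ρ h (i + j) a = conjEnd ρ (h ^ i) (conjLog ρ h j a) := by
  rw [conjLog, conjLog, conjEnd_map_sub_one]
  congr 2
  group

theorem conjLog_zero (ρ : G →* Module.End K W) (h a : G) : conjLog ρ h 0 a = ρ a - 1 := by
  simp [conjLog]

theorem conjEnd_conjLog (ρ : G →* Module.End K W) (h : G) (i : ℤ) (a : G) :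
    conjEnd ρ h (conjLog ρ h i a) = conjLog ρ h (i + 1) a := by
  rw [add_comm, conjLog_eq_conjEnd, zpow_one]

/-- With `x = ρ a - 1` and `y = ρ b - 1`, the two conjugates give `x y x - x y x y = 0` and `-x y x
- x y x y = 0`; subtract. -/
theorem mul_mul_eq_zero_of_conj_mem {ρ : G →* Module.End K W} (h2 : (2 : K) ≠ 0) {A : Subgroup G}
    (hA : ∀ a ∈ A, ∀ b ∈ A, (ρ a - 1) * (ρ b - 1) = 0) {a b : G} (ha : a ∈ A)
    (hy : (ρ b - 1) * (ρ b - 1) = 0) (h₁ : b * a * b⁻¹ ∈ A) (h₁' : b⁻¹ * a * b ∈ A) :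
    (ρ a - 1) * (ρ b - 1) * (ρ a - 1) = 0 := by
  have e₁ := hA a ha _ h₁
  have e₂ := hA a ha _ h₁'
  have hxx := hA a ha a ha
  have hb : ρ b = 1 + (ρ b - 1) := by abel
  have hb' := map_inv_eq_one_sub ρ hb hy
  have ha' : ρ a = 1 + (ρ a - 1) := by abel
  rw [map_mul, map_mul, hb'] at e₁ e₂
  generalize ρ a - 1 = x at *
  generalize ρ b - 1 = y at *
  rw [ha', hb] at e₁ e₂
  have : (2 : K) • (x * y * x) = 0 := by
    have h3 : (2 : K) • (x * y * x) = x * y * x + x * y * x := by module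
    rw [h3]
    linear_combination (norm := noncomm_ring) e₁ - e₂ + 2 * (hxx * y)
  exact (smul_eq_zero_iff_right h2).1 this

end Conjugation

end ProductSubgroups

namespace ProductSubgroups

open scoped commutatorElement

/-! ### Quadratic groups as spaces with zero multiplication. -/

section LogSpace

variable {p : ℕ} {W G : Type*} [Fact p.Prime] [AddCommGroup W] [Module (ZMod p) W] [Group G]

/-- The subspace `{ρ a - 1 | a ∈ A}` for a group `A` that acts quadratically. -/
def logSpace (ρ : G →* Module.End (ZMod p) W) (A : Subgroup G)
    (hA : ∀ a ∈ A, ∀ b ∈ A, (ρ a - 1) * (ρ b - 1) = 0) :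
    Submodule (ZMod p) (Module.End (ZMod p) W) :=
  AddSubgroup.toZModSubmodule p
    { carrier := {x | ∃ a ∈ A, x = ρ a - 1}
      add_mem' := by
        rintro _ _ ⟨a, ha, rfl⟩ ⟨b, hb, rfl⟩
        refine ⟨a * b, A.mul_mem ha hb, ?_⟩
        rw [map_mul]
        linear_combination (norm := noncomm_ring) - hA a ha b hb
      zero_mem' := ⟨1, A.one_mem, by simp⟩
      neg_mem' := by
        rintro _ ⟨a, ha, rfl⟩
        refine ⟨a⁻¹, A.inv_mem ha, ?_⟩
        rw [map_inv_eq_one_sub ρ (g := a) (x := ρ a - 1) (by abel) (hA a ha a ha)]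
        abel }

variable {ρ : G →* Module.End (ZMod p) W} {A : Subgroup G}
  {hA : ∀ a ∈ A, ∀ b ∈ A, (ρ a - 1) * (ρ b - 1) = 0}

theorem mem_logSpace {x : Module.End (ZMod p) W} : x ∈ logSpace ρ A hA ↔ ∃ a ∈ A, x = ρ a - 1 :=
  Iff.rfl

theorem card_logSpace [Finite W] [Finite G] (hρ : Function.Injective ρ) :
    Nat.card (logSpace ρ A hA) = Nat.card A := by
  symm
  refine Nat.card_congr (Equiv.ofBijective (fun a => ⟨ρ a - 1, a, a.2, rfl⟩) ⟨?_, ?_⟩)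
  · intro a b hab
    exact Subtype.ext (hρ (sub_left_injective (congrArg Subtype.val hab)))
  · rintro ⟨_, a, ha, rfl⟩
    exact ⟨⟨a, ha⟩, rfl⟩

/-- The subgroup of all `g` with `ρ g - 1 ∈ Y`, where `Y` has zero multiplication. -/
def expGroup (ρ : G →* Module.End (ZMod p) W) (Y : Submodule (ZMod p) (Module.End (ZMod p) W))
    (hY : ∀ x ∈ Y, ∀ y ∈ Y, x * y = 0) : Subgroup G where
  carrier := {g | ρ g - 1 ∈ Y}
  mul_mem' := by
    intro a b ha hb
    change ρ (a * b) - 1 ∈ Y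
    have : ρ (a * b) - 1 = (ρ a - 1) + (ρ b - 1) := by
      rw [map_mul]
      linear_combination (norm := noncomm_ring) hY _ ha _ hb
    rw [this]
    exact Y.add_mem ha hb
  one_mem' := by simp
  inv_mem' := by
    intro a ha
    change ρ a⁻¹ - 1 ∈ Y
    rw [map_inv_eq_one_sub ρ (g := a) (x := ρ a - 1) (by abel) (hY _ ha _ ha)]
    simpa using Y.neg_mem ha

variable {Y : Submodule (ZMod p) (Module.End (ZMod p) W)} {hY : ∀ x ∈ Y, ∀ y ∈ Y, x * y = 0}

theorem mem_expGroup {g : G} : g ∈ expGroup ρ Y hY ↔ ρ g - 1 ∈ Y := Iff.rfl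

theorem card_expGroup [Finite W] [Finite G] (hρ : Function.Injective ρ)
    (h : ∀ y ∈ Y, ∃ g, ρ g = 1 + y) : Nat.card (expGroup ρ Y hY) = Nat.card Y := by
  refine Nat.card_congr (Equiv.ofBijective (fun g => ⟨ρ g.1 - 1, g.2⟩) ⟨?_, ?_⟩)
  · intro a b hab
    exact Subtype.ext (hρ (sub_left_injective (congrArg Subtype.val hab)))
  · rintro ⟨y, hy⟩
    obtain ⟨g, hg⟩ := h y hy
    exact ⟨⟨g, by rw [mem_expGroup, hg, add_sub_cancel_left]; exact hy⟩,
      Subtype.ext (by simp [hg])⟩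

theorem isAbelianPair_expGroup (hρ : Function.Injective ρ) {U : Submodule (ZMod p) W}
    (h : ∀ y ∈ Y, ∀ u ∈ U, y u = 0) : IsAbelianPair ρ U (expGroup ρ Y hY) := by
  refine ⟨fun a ha b hb => hρ ?_, fun a ha u hu => sub_eq_zero.1 (h _ ha u hu)⟩
  rw [map_mul, map_mul]
  linear_combination (norm := noncomm_ring) hY _ ha _ hb - hY _ hb _ ha

end LogSpace

/-! ### Consequences of normality and of the commutator condition. -/

section Replacement

variable {p : ℕ} {W G : Type*} [Fact p.Prime] [AddCommGroup W] [Module (ZMod p) W] [Group G]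
  {ρ : G →* Module.End (ZMod p) W} {A : Subgroup G} {h : G}

theorem conjLog_mul_conjLog (hA : ∀ a ∈ A, ∀ b ∈ A, (ρ a - 1) * (ρ b - 1) = 0) (i : ℤ) {a b : G}
    (ha : a ∈ A) (hb : b ∈ A) : conjLog ρ h i a * conjLog ρ h i b = 0 := by
  have := conjLog_eq_conjEnd ρ h i 0
  rw [add_zero] at this
  rw [this, this, ← conjEnd_mul, conjLog_zero, conjLog_zero, hA a ha b hb, map_zero]

theorem conjLog_mul (hA : ∀ a ∈ A, ∀ b ∈ A, (ρ a - 1) * (ρ b - 1) = 0) (i : ℤ) {a b : G}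
    (ha : a ∈ A) (hb : b ∈ A) : conjLog ρ h i (a * b) = conjLog ρ h i a + conjLog ρ h i b := by
  have := conjLog_eq_conjEnd ρ h i 0
  rw [add_zero] at this
  rw [this, this, this, ← map_add, conjLog_zero, conjLog_zero, conjLog_zero, map_mul]
  congr 1
  linear_combination (norm := noncomm_ring) hA a ha b hb

theorem conjLog_one (i : ℤ) : conjLog ρ h i 1 = 0 := by
  simp [conjLog]

theorem conjLog_inv (hA : ∀ a ∈ A, ∀ b ∈ A, (ρ a - 1) * (ρ b - 1) = 0) (i : ℤ) {a : G}
    (ha : a ∈ A) : conjLog ρ h i a⁻¹ = - conjLog ρ h i a := by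
  have := conjLog_mul (h := h) hA i ha (A.inv_mem ha)
  rw [mul_inv_cancel, conjLog_one] at this
  exact (neg_eq_of_add_eq_zero_right this.symm).symm

theorem conjLog_mul_mul_eq_zero (h2 : (2 : ZMod p) ≠ 0)
    (hA : ∀ a ∈ A, ∀ b ∈ A, (ρ a - 1) * (ρ b - 1) = 0)
    (hn : ∀ i : ℤ, ∀ a ∈ A, ∀ b ∈ A, h ^ i * b * h ^ (-i) * a * (h ^ i * b * h ^ (-i))⁻¹ ∈ A)
    (i j : ℤ) {a b : G} (ha : a ∈ A) (hb : b ∈ A) :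
    conjLog ρ h i a * conjLog ρ h j b * conjLog ρ h i a = 0 := by
  have hi := conjLog_eq_conjEnd ρ h i 0 a
  have hj := conjLog_eq_conjEnd ρ h i (j - i) b
  rw [add_zero] at hi
  rw [add_sub_cancel] at hj
  rw [hi, hj, ← conjEnd_mul, ← conjEnd_mul, conjLog_zero]
  have := mul_mul_eq_zero_of_conj_mem (ρ := ρ) h2 hA ha (b := h ^ (j - i) * b * h ^ (-(j - i)))
    (conjLog_mul_conjLog hA (j - i) hb hb) (hn _ a ha b hb) (by
      convert hn (j - i) a ha b⁻¹ (A.inv_mem hb) using 1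
      group)
  rw [← conjLog] at this
  rw [this, map_zero]

/-- The condition `[A, h; 3] = 1` makes conjugation by `h` on `{ρ a - 1}` unipotent of degree `3`. -/
theorem conjEnd_sub_one_pow_three (h2 : (2 : ZMod p) ≠ 0) (h3 : (3 : ZMod p) ≠ 0)
    (hA : ∀ a ∈ A, ∀ b ∈ A, (ρ a - 1) * (ρ b - 1) = 0)
    (hc : ∀ a ∈ A, ∀ c, c = a⁻¹ * (h * a * h⁻¹) → ∀ d, d = c⁻¹ * (h * c * h⁻¹) →
      h * d * h⁻¹ = d) {a : G} (ha : a ∈ A) :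
    (conjEnd ρ h - 1) ((conjEnd ρ h - 1) ((conjEnd ρ h - 1) (ρ a - 1))) = 0 := by
  have hpow : ∀ (i : ℤ) (k : ℕ), ρ (h ^ i * a ^ k * h ^ (-i)) =
      1 + (k : ZMod p) • conjLog ρ h i a := by
    intro i k
    have : h ^ i * a ^ k * h ^ (-i) = (h ^ i * a * h ^ (-i)) ^ k := by
      rw [zpow_neg, conj_pow]
    rw [this, map_pow, map_conj_eq, one_add_pow_of_sq_eq_zero (conjLog_mul_conjLog hA i ha ha),
      ← nsmul_eq_mul, Nat.cast_smul_eq_nsmul]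
  have hpow' : ∀ (i : ℤ) (k : ℕ), ρ (h ^ i * a ^ k * h ^ (-i))⁻¹ =
      1 - (k : ZMod p) • conjLog ρ h i a := by
    intro i k
    refine map_inv_eq_one_sub ρ (hpow i k) ?_
    rw [smul_mul_smul_comm, conjLog_mul_conjLog hA i ha ha, smul_zero]
  have e0 : conjLog ρ h 0 a = ρ a - 1 := conjLog_zero ρ h a
  have e1 : conjEnd ρ h (conjLog ρ h 0 a) = conjLog ρ h 1 a := conjEnd_conjLog ρ h 0 a
  have e2 : conjEnd ρ h (conjLog ρ h 1 a) = conjLog ρ h 2 a := conjEnd_conjLog ρ h 1 a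
  have hd : ∀ k : ℕ, conjEnd ρ h
      ((1 - (k : ZMod p) • conjLog ρ h 1 a) * (1 + (k : ZMod p) • conjLog ρ h 0 a) *
        (1 - (k : ZMod p) • conjLog ρ h 1 a) * (1 + (k : ZMod p) • conjLog ρ h 2 a)) =
      (1 - (k : ZMod p) • conjLog ρ h 1 a) * (1 + (k : ZMod p) • conjLog ρ h 0 a) *
        (1 - (k : ZMod p) • conjLog ρ h 1 a) * (1 + (k : ZMod p) • conjLog ρ h 2 a) := by
    intro k
    rw [← hpow, ← hpow, ← hpow', ← map_mul, ← map_mul, ← map_mul, conjEnd_apply, ← map_mul,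
      ← map_mul]
    congr 1
    refine hc (a ^ k) (A.pow_mem ha k) _ rfl _ ?_
    have c1 : h ^ (1 : ℤ) * a ^ k * h ^ (-1 : ℤ) = h * a ^ k * h⁻¹ := by simp
    have c0 : h ^ (0 : ℤ) * a ^ k * h ^ (-0 : ℤ) = a ^ k := by simp
    have c2 : h ^ (2 : ℤ) * a ^ k * h ^ (-2 : ℤ) = h * (h * a ^ k * h⁻¹) * h⁻¹ := by
      simp only [zpow_ofNat, zpow_neg, pow_two, mul_inv_rev, mul_assoc]
    rw [c0, c1, c2]
    generalize a ^ k = b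
    group
  rw [← e0]
  generalize conjLog ρ h 0 a = x at *
  generalize conjLog ρ h 1 a = y at *
  generalize conjLog ρ h 2 a = z at *
  -- For `a ^ k` the double commutator with `h` is a quartic polynomial in `k` fixed by conjugation.
  -- So its linear coefficient `x - 2 y + z`, which is `(T - 1) ^ 2 x` for `T = conjEnd ρ h`, is
  -- fixed too.
  have key := (coeff_eq_zero_of_quartic h2 h3 (c₀ := 0)
    (c₁ := (conjEnd ρ h - 1) (x - (2 : ZMod p) • y + z))
    (c₂ := (conjEnd ρ h - 1) (y * y - (2 : ZMod p) • (y * z) - y * x - x * y + x * z))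
    (c₃ := (conjEnd ρ h - 1) (y * x * y - y * x * z + y * y * z - x * y * z))
    (c₄ := (conjEnd ρ h - 1) (y * x * y * z)) (fun k => by
      have h0 : (conjEnd ρ h - 1) 1 = 0 := by
        rw [LinearMap.sub_apply, conjEnd_apply, mul_one, map_mul_map_inv, Module.End.one_apply,
          sub_self]
      have h1 : (conjEnd ρ h - 1) ((1 - (k : ZMod p) • y) * (1 + (k : ZMod p) • x) *
          (1 - (k : ZMod p) • y) * (1 + (k : ZMod p) • z)) = 0 := sub_eq_zero.2 (hd k)
      generalize (k : ZMod p) = c at *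
      have h4 : (1 - c • y) * (1 + c • x) * (1 - c • y) * (1 + c • z) =
          1 + c • (x - (2 : ZMod p) • y + z) +
          c ^ 2 • (y * y - (2 : ZMod p) • (y * z) - y * x - x * y + x * z) +
          c ^ 3 • (y * x * y - y * x * z + y * y * z - x * y * z) + c ^ 4 • (y * x * y * z) := by
        simp only [add_mul, mul_add, sub_mul, mul_sub, smul_mul_assoc, mul_smul_comm, one_mul,
          mul_one, mul_assoc]
        module
      rw [h4] at h1
      simpa only [map_add, map_smul, h0] using h1)).1
  have e3 : (conjEnd ρ h - 1) ((conjEnd ρ h - 1) x) = x - (2 : ZMod p) • y + z := by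
    simp only [LinearMap.sub_apply, Module.End.one_apply, e1, e2, map_sub]
    module
  rw [e3, key]

end Replacement

end ProductSubgroups

namespace ProductSubgroups

open scoped commutatorElement

/-! ### The limit pair and stability under `h`. -/

section Stable

variable {p : ℕ} {W G : Type*} [Fact p.Prime] [AddCommGroup W] [Module (ZMod p) W] [Group G]
  {ρ : G →* Module.End (ZMod p) W} {A : Subgroup G} {h : G}

theorem exists_map_eq_one_add_conjLog (hp : p ≠ 2) (h2 : (2 : ZMod p) ≠ 0)
    (hA : ∀ a ∈ A, ∀ b ∈ A, (ρ a - 1) * (ρ b - 1) = 0)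
    (hn : ∀ i : ℤ, ∀ a ∈ A, ∀ b ∈ A, h ^ i * b * h ^ (-i) * a * (h ^ i * b * h ^ (-i))⁻¹ ∈ A)
    (H : Subgroup G) {a b c : G} (ha : a ∈ A) (hb : b ∈ A) (hc : c ∈ A)
    (hH : ∀ g₁ g₂ g₃, g₁ = a → g₂ = h * b * h⁻¹ → g₃ = h ^ 2 * c * (h ^ 2)⁻¹ →
      g₁ * g₂ * g₃ ∈ H ∧ ⁅g₁, g₂⁆ ∈ H ∧ ⁅g₁, g₃⁆ ∈ H ∧ ⁅g₂, g₃⁆ ∈ H)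
    (hq : (conjLog ρ h 0 a + conjLog ρ h 1 b + conjLog ρ h 2 c) *
      (conjLog ρ h 0 a + conjLog ρ h 1 b + conjLog ρ h 2 c) = 0) :
    ∃ g ∈ H, ρ g = 1 + (conjLog ρ h 0 a + conjLog ρ h 1 b + conjLog ρ h 2 c) := by
  obtain ⟨hH, h₁₂, h₁₃, h₂₃⟩ := hH (h ^ (0 : ℤ) * a * h ^ (-0 : ℤ))
    (h ^ (1 : ℤ) * b * h ^ (-1 : ℤ)) (h ^ (2 : ℤ) * c * h ^ (-2 : ℤ)) (by simp) (by simp)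
    (by rw [zpow_neg, zpow_ofNat])
  have hpp : p.Prime := Fact.out
  -- The exponent `(p - 1) / 2` represents `-1/2` modulo `p`.
  have hm : (2 * ((p - 1) / 2 : ℕ) + 1 : Module.End (ZMod p) W) = 0 := by
    have h1 : 2 * ((p - 1) / 2) + 1 = p := by
      have := hpp.eq_two_or_odd'.resolve_left hp
      obtain ⟨k, hk⟩ := this
      omega
    have h3 : ((2 * ((p - 1) / 2) + 1 : ℕ) : Module.End (ZMod p) W) = 0 := by
      rw [h1]
      ext v
      rw [← map_natCast (algebraMap (ZMod p) (Module.End (ZMod p) W)), ZMod.natCast_self]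
      simp
    exact_mod_cast h3
  exact exists_map_eq_one_add_add ρ hm H (map_conj_eq ..) (map_conj_eq ..) (map_conj_eq ..)
    hH h₁₂ h₁₃ h₂₃ (conjLog_mul_conjLog hA _ ha ha) (conjLog_mul_conjLog hA _ hb hb)
    (conjLog_mul_conjLog hA _ hc hc) (conjLog_mul_mul_eq_zero h2 hA hn _ _ ha hb)
    (conjLog_mul_mul_eq_zero h2 hA hn _ _ hb ha) (conjLog_mul_mul_eq_zero h2 hA hn _ _ ha hc)
    (conjLog_mul_mul_eq_zero h2 hA hn _ _ hc ha) (conjLog_mul_mul_eq_zero h2 hA hn _ _ hb hc)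
    (conjLog_mul_mul_eq_zero h2 hA hn _ _ hc hb) hq

/-- Every element of the limit of `{ρ a - 1 | a ∈ B}` has the form required by
`exists_map_eq_one_add_conjLog`. -/
theorem exists_conjLog_of_mem_limitSpace (h2 : (2 : ZMod p) ≠ 0) {B : Subgroup G}
    {hB : ∀ a ∈ B, ∀ b ∈ B, (ρ a - 1) * (ρ b - 1) = 0} {y : Module.End (ZMod p) W}
    (hy : y ∈ limitSpace (linTerm (conjEnd ρ h)) (quadTerm (conjEnd ρ h)) (logSpace ρ B hB)) :
    ∃ a ∈ B, ∃ b ∈ B, ∃ c ∈ B, y = conjLog ρ h 0 a + conjLog ρ h 1 b + conjLog ρ h 2 c := by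
  obtain ⟨x₂, hx₂, x₁, hx₁, x₀, hx₀, rfl⟩ := exists_of_mem_limitSpace hy
  set N := logSpace ρ B hB
  -- These are the coefficients of `1`, `T`, `T ^ 2` in `x₂ + E x₁ + F x₀`, where `E = -3/2 + 2 T -
  -- T ^ 2 / 2` and `F = 1/2 - T + T ^ 2 / 2`.
  have m0 : x₂ - ((2⁻¹ : ZMod p) * 3) • x₁ + (2⁻¹ : ZMod p) • x₀ ∈ N :=
    N.add_mem (N.sub_mem hx₂ (N.smul_mem _ hx₁)) (N.smul_mem _ hx₀)
  have m1 : (2 : ZMod p) • x₁ - x₀ ∈ N := N.sub_mem (N.smul_mem _ hx₁) hx₀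
  have m2 : (2⁻¹ : ZMod p) • (x₀ - x₁) ∈ N := N.smul_mem _ (N.sub_mem hx₀ hx₁)
  obtain ⟨a, ha, ea⟩ := mem_logSpace.1 m0
  obtain ⟨b, hb, eb⟩ := mem_logSpace.1 m1
  obtain ⟨c, hc, ec⟩ := mem_logSpace.1 m2
  refine ⟨a, ha, b, hb, c, hc, ?_⟩
  have e1 : conjLog ρ h 1 b = conjEnd ρ h (ρ b - 1) := by
    rw [← conjLog_zero ρ h, conjEnd_conjLog]; rfl
  have e2 : conjLog ρ h 2 c = conjEnd ρ h (conjEnd ρ h (ρ c - 1)) := by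
    rw [← conjLog_zero ρ h, conjEnd_conjLog, conjEnd_conjLog]; rfl
  rw [conjLog_zero, e1, e2, ← ea, ← eb, ← ec]
  simp only [linTerm, quadTerm, LinearMap.sub_apply, LinearMap.smul_apply, Module.End.mul_apply,
    Module.End.one_apply, map_sub, map_smul]
  generalize conjEnd ρ h x₁ = y₁
  generalize conjEnd ρ h x₀ = y₀
  generalize conjEnd ρ h y₁ = z₁
  generalize conjEnd ρ h y₀ = z₀
  match_scalars <;> field_simp <;> ring

theorem IsMaximalPair.stable [Finite W] [Finite G] (hp5 : 5 ≤ p) (hρ : Function.Injective ρ)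
    {n : ℕ} {Y : ℕ → Submodule (ZMod p) W} {Z : ℕ → Subgroup G} {U : Submodule (ZMod p) W}
    (hZ : IsCentralPairSeries ρ n Y Z) (hM : IsMaximalPair ρ n Y Z U A)
    (hn : ∀ i : ℤ, ∀ a ∈ A, ∀ b ∈ A, h ^ i * b * h ^ (-i) * a * (h ^ i * b * h ^ (-i))⁻¹ ∈ A)
    (hc : ∀ a ∈ A, ∀ c, c = a⁻¹ * (h * a * h⁻¹) → ∀ d, d = c⁻¹ * (h * c * h⁻¹) →
      h * d * h⁻¹ = d)
    (hu : ∀ u ∈ U, (ρ h - 1) ((ρ h - 1) ((ρ h - 1) u)) = 0) :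
    (∀ u ∈ U, ρ h u ∈ U) ∧ ∀ a ∈ A, h * a * h⁻¹ ∈ A := by
  have : Finite (Module.End (ZMod p) W) :=
    Finite.of_injective (fun f : Module.End (ZMod p) W => (f : W → W)) DFunLike.coe_injective
  have hp2 : p ≠ 2 := by omega
  have h2 : (2 : ZMod p) ≠ 0 := by
    intro h0
    have := (ZMod.natCast_eq_zero_iff 2 p).1 (by exact_mod_cast h0)
    have := Nat.le_of_dvd (by norm_num) this
    omega
  have h3 : (3 : ZMod p) ≠ 0 := by
    intro h0
    have := (ZMod.natCast_eq_zero_iff 3 p).1 (by exact_mod_cast h0)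
    have := Nat.le_of_dvd (by norm_num) this
    omega
  have hA : ∀ a ∈ A, ∀ b ∈ A, (ρ a - 1) * (ρ b - 1) = 0 := fun a ha b hb =>
    hM.sub_one_mul_sub_one (hM.quadratic hZ) ha hb
  set T := conjEnd ρ h with hT
  have hAi : ∀ i, ∀ a ∈ A ⊓ Z i, ∀ b ∈ A ⊓ Z i, (ρ a - 1) * (ρ b - 1) = 0 :=
    fun i a ha b hb => hA a ha.1 b hb.1
  -- the limits of `U` and of `{ρ a - 1 | a ∈ A}`, and those of the intersections with the series
  let N := logSpace ρ A hA
  let Ni := fun i => logSpace ρ (A ⊓ Z i) (hAi i)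
  let LV := limitSpace (linTerm (ρ h)) (quadTerm (ρ h))
  let LE := limitSpace (linTerm T) (quadTerm T)
  have hNi : ∀ i, Ni i ≤ N := by
    rintro i _ ⟨a, ha, rfl⟩
    exact ⟨a, ha.1, rfl⟩
  have hTN : ∀ x ∈ N, (T - 1) ((T - 1) ((T - 1) x)) = 0 := by
    rintro _ ⟨a, ha, rfl⟩
    exact conjEnd_sub_one_pow_three h2 h3 hA hc ha
  have hLL : ∀ x ∈ LE N, ∀ y ∈ LE N, x * y = 0 := by
    intro x hx y hy
    refine apply_limitSpace_eq_zero_of_pow h2 h3 (LinearMap.mul (ZMod p) (Module.End (ZMod p) W))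
      hTN hTN ?_ hx hy
    rintro _ ⟨a, ha, rfl⟩ _ ⟨b, hb, rfl⟩ k
    rw [LinearMap.mul_apply', ← conjEnd_pow_mul, hA a ha b hb, map_zero]
  have hLU : ∀ x ∈ LE N, ∀ u ∈ LV U, x u = 0 := by
    intro x hx u hu'
    refine apply_limitSpace_eq_zero_of_pow h2 h3 (LinearMap.id : Module.End (ZMod p) W →ₗ[ZMod p] _)
      hTN hu ?_ hx hu'
    rintro _ ⟨a, ha, rfl⟩ u hu k
    rw [LinearMap.id_apply, conjEnd_pow_apply, LinearMap.sub_apply, hM.isAbelianPair.2 a ha u hu,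
      Module.End.one_apply, sub_self, map_zero]
  have hLi : ∀ i, LE (Ni i) ≤ LE N := fun i => limitSpace_mono _ _ (hNi i)
  have hexp : ∀ i ≤ n, ∀ y ∈ LE (Ni i), ∃ g ∈ Z i, ρ g = 1 + y := by
    intro i hi y hy
    obtain ⟨a, ha, b, hb, c, hc, rfl⟩ := exists_conjLog_of_mem_limitSpace h2 hy
    refine exists_map_eq_one_add_conjLog hp2 h2 hA hn (Z i) ha.1 hb.1 hc.1 ?_
      (hLL _ (hLi i hy) _ (hLi i hy))
    rintro g₁ g₂ g₃ rfl e₂ e₃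
    have m₁ := ha.2
    have m₂ := hZ.conj_mem hi hb.2 h
    have m₃ := hZ.conj_mem hi hc.2 (h ^ 2)
    rw [← e₂] at m₂
    rw [← e₃] at m₃
    have cm : ∀ x ∈ Z i, ∀ y ∈ Z i, ⁅x, y⁆ ∈ Z i := fun x hx y hy => by
      rw [commutatorElement_def]
      exact mul_mem (mul_mem (mul_mem hx hy) (inv_mem hx)) (inv_mem hy)
    exact ⟨mul_mem (mul_mem m₁ m₂) m₃, cm _ m₁ _ m₂, cm _ m₁ _ m₃, cm _ m₂ _ m₃⟩
  have hNn : Ni n = N := by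
    refine le_antisymm (hNi n) ?_
    rintro _ ⟨a, ha, rfl⟩
    exact ⟨a, ⟨ha, by rw [hZ.right_last]; trivial⟩, rfl⟩
  let H := expGroup ρ (LE N) hLL
  let Hi := fun i => expGroup ρ (LE (Ni i)) (fun x hx y hy => hLL x (hLi i hx) y (hLi i hy))
  have hHi : ∀ i ≤ n, Hi i ≤ H ⊓ Z i := by
    intro i hi g hg
    refine ⟨hLi i hg, ?_⟩
    obtain ⟨g', hg', e⟩ := hexp i hi _ hg
    rwa [hρ (show ρ g = ρ g' by rw [e]; abel)]
  have hcHi : ∀ i ≤ n, Nat.card ↥(A ⊓ Z i) ≤ Nat.card (Hi i) := by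
    intro i hi
    rw [card_expGroup hρ (fun y hy => (hexp i hi y hy).imp fun _ h => h.2),
      ← card_logSpace (hA := hAi i) hρ]
    exact card_le_card_limitSpace _ _ _
  have hDY : ∀ i ≤ n, ∀ v ∈ Y i, (ρ h - 1) v ∈ Y i := fun i hi v hv =>
    (Y i).sub_mem (hZ.map_mem hi hv h) hv
  have hUi : ∀ i ≤ n, LV (U ⊓ Y i) ≤ LV U ⊓ Y i := fun i hi =>
    le_inf (limitSpace_mono _ _ inf_le_left) (limitSpace_le inf_le_right
      (fun x hx => linTerm_mem (hDY i hi _ hx.2) (hDY i hi _ (hDY i hi _ hx.2)))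
      (fun x hx => quadTerm_mem (hDY i hi _ (hDY i hi _ hx.2))))
  have hcUi : ∀ i, Nat.card ↥(U ⊓ Y i) ≤ Nat.card (LV (U ⊓ Y i)) := fun i =>
    card_le_card_limitSpace _ _ _
  have hHbot : H ≠ ⊥ := by
    intro hH
    have h4 := hcHi n le_rfl
    have h5 := card_subgroup_le ((hHi n le_rfl).trans inf_le_left)
    rw [hZ.right_last, inf_top_eq] at h4
    rw [hH, Subgroup.card_bot] at h5
    exact hM.ne_bot (Subgroup.card_le_one_iff_eq_bot A |>.1 (h4.trans h5))
  -- The limit pair is abelian and no smaller on any term of the series, so all these products of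
  -- orders agree; each factor then agrees as well.
  have heq := hM.card_eq (LV U) H (isAbelianPair_expGroup hρ hLU) hHbot fun i hi =>
    Nat.mul_le_mul ((hcUi i).trans (card_submodule_le (hUi i hi)))
      ((hcHi i hi).trans (card_subgroup_le (hHi i hi)))
  have hUeq : ∀ i ≤ n, LV (U ⊓ Y i) = LV U ⊓ Y i := by
    intro i hi
    refine submodule_eq_of_le_of_card_le (hUi i hi) (le_trans ?_ (hcUi i))
    refine Nat.le_of_mul_le_mul_right (c := Nat.card ↥(H ⊓ Z i)) ?_ Nat.card_pos
    rw [← heq i hi]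
    exact Nat.mul_le_mul_left _ ((hcHi i hi).trans (card_subgroup_le (hHi i hi)))
  have hHeq : ∀ i ≤ n, Hi i = H ⊓ Z i := by
    intro i hi
    refine subgroup_eq_of_le_of_card_le (hHi i hi) (le_trans ?_ (hcHi i hi))
    refine Nat.le_of_mul_le_mul_left (c := Nat.card ↥(LV U ⊓ Y i)) ?_ Nat.card_pos
    rw [← heq i hi]
    exact Nat.mul_le_mul_right _ ((hcUi i).trans (card_submodule_le (hUi i hi)))
  -- By induction `U ⊓ Y i` is stable, hence contains its own limit, which is `LV U ⊓ Y i`. For `u ∈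
  -- U ⊓ Y (i + 1)` the quadratic term lies there, and then so does the linear term.
  have stepU : ∀ i ≤ n, ∀ u ∈ U ⊓ Y i, (ρ h - 1) u ∈ U ⊓ Y i := by
    intro i
    induction i with
    | zero =>
      intro _ u hu
      rw [hZ.left_zero, inf_bot_eq, Submodule.mem_bot] at hu
      rw [hu, map_zero]
      exact zero_mem _
    | succ i ih =>
      intro hi u hu'
      have hi' : i ≤ n := by omega
      have ih := ih hi'
      have hle : LV U ⊓ Y i ≤ U ⊓ Y i := by
        rw [← hUeq i hi']
        exact limitSpace_le le_rfl (fun x hx => linTerm_mem (ih _ hx) (ih _ (ih _ hx)))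
          (fun x hx => quadTerm_mem (ih _ (ih _ hx)))
      have d1 : (ρ h - 1) u ∈ Y i := hZ.left_sub_mem i hi u hu'.2 h
      have d2 := hDY i hi' _ d1
      have hF := hle ⟨apply_two_mem_limitSpace hu'.1, quadTerm_mem d2⟩
      have hE := hle ⟨apply_one_mem_limitSpace hu'.1 hF.1 (linTerm_quadTerm (hu u hu'.1))
        (quadTerm_quadTerm (hu u hu'.1)), linTerm_mem d1 d2⟩
      have := (U ⊓ Y i).add_mem hE hF
      rw [linTerm_add_quadTerm] at this
      exact ⟨this.1, hZ.left_le i hi this.2⟩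
  have stepN : ∀ i ≤ n, ∀ x ∈ Ni i, (T - 1) x ∈ Ni i := by
    intro i
    induction i with
    | zero =>
      rintro _ _ ⟨a, ha, rfl⟩
      rw [hZ.right_zero, inf_bot_eq, Subgroup.mem_bot] at ha
      rw [ha, map_one, sub_self, map_zero]
      exact zero_mem _
    | succ i ih =>
      rintro hi _ ⟨a, ha, rfl⟩
      have hi' : i ≤ n := by omega
      have ih := ih hi'
      have hx : ρ a - 1 ∈ N := ⟨a, ha.1, rfl⟩
      have hle : LE (Ni i) ≤ Ni i :=
        limitSpace_le le_rfl (fun x hx => linTerm_mem (ih _ hx) (ih _ (ih _ hx)))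
          (fun x hx => quadTerm_mem (ih _ (ih _ hx)))
      -- Modulo `Z i` conjugation by `h` is trivial on `Z (i + 1)` and commutators vanish. Hence the
      -- group element realizing the sum is congruent to `b * c * d = 1` and lies in `H ⊓ Z i = Hi
      -- i`.
      have key : ∀ b ∈ A ⊓ Z (i + 1), ∀ c ∈ A ⊓ Z (i + 1), ∀ d ∈ A ⊓ Z (i + 1), b * c * d = 1 →
          conjLog ρ h 0 b + conjLog ρ h 1 c + conjLog ρ h 2 d ∈ LE N →
          conjLog ρ h 0 b + conjLog ρ h 1 c + conjLog ρ h 2 d ∈ Ni i := by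
        intro b hb c hc d hd hbcd hL
        obtain ⟨g, hg, e⟩ := exists_map_eq_one_add_conjLog hp2 h2 hA hn (Z i) hb.1 hc.1 hd.1
          (by
            rintro g₁ g₂ g₃ rfl e₂ e₃
            have m₂ := hZ.conj_mem hi hc.2 h
            rw [← e₂] at m₂
            refine ⟨?_, hZ.right_commutator_mem i hi _ hb.2 _,
              hZ.right_commutator_mem i hi _ hb.2 _, hZ.right_commutator_mem i hi _ m₂ _⟩
            have k₂ := (Z i).inv_mem (hZ.right_commutator_mem i hi c hc.2 h)
            have k₃ := (Z i).inv_mem (hZ.right_commutator_mem i hi d hd.2 (h ^ 2))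
            have := (Z i).mul_mem (hZ.conj_mem hi' k₂ g₁) (hZ.conj_mem hi' k₃ (g₁ * c))
            have e : g₁ * g₂ * g₃ = g₁ * ⁅c, h⁆⁻¹ * g₁⁻¹ *
                (g₁ * c * ⁅d, h ^ 2⁆⁻¹ * (g₁ * c)⁻¹) * (g₁ * c * d) := by
              rw [e₂, e₃]
              simp only [commutatorElement_def]
              group
            rw [e, hbcd, mul_one]
            exact this) (hLL _ hL _ hL)
        refine hle ?_
        have hgH : g ∈ H ⊓ Z i := by
          refine ⟨?_, hg⟩
          change ρ g - 1 ∈ LE N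
          rw [e, add_sub_cancel_left]
          exact hL
        rw [← hHeq i hi'] at hgH
        have : ρ g - 1 ∈ LE (Ni i) := hgH
        rwa [e, add_sub_cancel_left] at this
      have e0 : conjLog ρ h 0 a = ρ a - 1 := conjLog_zero ρ h a
      have e1 : T (conjLog ρ h 0 a) = conjLog ρ h 1 a := conjEnd_conjLog ρ h 0 a
      have e2 : T (conjLog ρ h 1 a) = conjLog ρ h 2 a := conjEnd_conjLog ρ h 1 a
      have hFL : quadTerm T (ρ a - 1) ∈ LE N := apply_two_mem_limitSpace hx
      -- The coefficients `1, -2, 1` of `(T - 1) ^ 2` sum to zero, so `a`, `a⁻²`, `a` have product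
      -- 1; likewise `a⁻¹`, `a`, `1` for `T - 1` below.
      have d2 : (T - 1) ((T - 1) (ρ a - 1)) ∈ Ni i := by
        have hL := (LE N).smul_mem (2 : ZMod p) hFL
        have ha' := A.inv_mem ha.1
        have e : (T - 1) ((T - 1) (ρ a - 1)) =
            conjLog ρ h 0 a + conjLog ρ h 1 (a⁻¹ * a⁻¹) + conjLog ρ h 2 a := by
          rw [conjLog_mul hA _ ha' ha', conjLog_inv hA _ ha.1, ← e0]
          simp only [LinearMap.sub_apply, Module.End.one_apply, map_sub, e1, e2]
          abel
        rw [two_smul_quadTerm h2] at hL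
        rw [e] at hL ⊢
        exact key a ha _ (mul_mem (inv_mem ha) (inv_mem ha)) a ha (by group) hL
      have hF : quadTerm T (ρ a - 1) ∈ Ni i := quadTerm_mem d2
      have hEL : linTerm T (ρ a - 1) ∈ LE N := apply_one_mem_limitSpace hx (hNi i hF)
        (linTerm_quadTerm (hTN _ hx)) (quadTerm_quadTerm (hTN _ hx))
      have d1 : (T - 1) (ρ a - 1) ∈ Ni i := by
        have hL := (LE N).add_mem hEL hFL
        rw [linTerm_add_quadTerm] at hL
        have e : (T - 1) (ρ a - 1) =
            conjLog ρ h 0 a⁻¹ + conjLog ρ h 1 a + conjLog ρ h 2 1 := by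
          rw [conjLog_one, conjLog_inv hA _ ha.1, ← e0]
          simp only [LinearMap.sub_apply, Module.End.one_apply, e1]
          abel
        rw [e] at hL ⊢
        exact key _ (inv_mem ha) a ha 1 (one_mem _) (by group) hL
      obtain ⟨b, hb, e⟩ := mem_logSpace.1 d1
      exact ⟨b, ⟨hb.1, hZ.right_le i hi hb.2⟩, e⟩
  refine ⟨fun u hu => ?_, fun a ha => ?_⟩
  · have h4 := stepU n le_rfl u ⟨hu, by rw [hZ.left_last]; trivial⟩
    have := U.add_mem h4.1 hu
    simpa using this
  · have h4 := stepN n le_rfl (ρ a - 1) (by rw [hNn]; exact ⟨a, ha, rfl⟩)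
    rw [hNn] at h4
    have hx : ρ a - 1 ∈ N := ⟨a, ha, rfl⟩
    have h5 := N.add_mem h4 hx
    rw [LinearMap.sub_apply, Module.End.one_apply, sub_add_cancel, conjEnd_map_sub_one] at h5
    obtain ⟨b, hb, e⟩ := mem_logSpace.1 h5
    rwa [hρ (sub_left_injective e)]

end Stable

end ProductSubgroups

namespace ProductSubgroups

open scoped commutatorElement
open SemidirectProduct

/-! ### Passage between subgroups of `V ⋊ G` and pairs. -/

section Translation

variable {V G : Type*} [CommGroup V] [Group G] {φ : G →* MulAut V}

theorem mem_timesSubgroup {B : Subgroup (V ⋊[φ] G)} {s : V ⋊[φ] G} :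
    s ∈ timesSubgroup B ↔ inl s.left ∈ B ∧ ∃ b ∈ B, b.right = s.right := by
  rw [← SetLike.mem_coe, coe_timesSubgroup, Set.mem_mul]
  constructor
  · rintro ⟨_, ⟨hv, ⟨v, rfl⟩⟩, _, ⟨_, ⟨b, hb, rfl⟩, rfl⟩, rfl⟩
    exact ⟨by simpa using hv, b, hb, by simp⟩
  · rintro ⟨hl, b, hb, e⟩
    refine ⟨inl s.left, ⟨hl, ⟨_, rfl⟩⟩, inr s.right, ⟨s.right, ⟨b, hb, e⟩, rfl⟩, ?_⟩
    exact inl_left_mul_inr_right s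

theorem isProductSubgroup_iff {B : Subgroup (V ⋊[φ] G)} :
    IsProductSubgroup B ↔ ∀ s, s ∈ B ↔ inl s.left ∈ B ∧ inr s.right ∈ B := by
  constructor
  · intro h s
    refine ⟨fun hs => ?_, fun hs => ?_⟩
    · have hs' := mem_timesSubgroup.1 (h ▸ hs)
      refine ⟨hs'.1, ?_⟩
      rw [h]
      exact mem_timesSubgroup.2 ⟨by simp, s, hs, by simp⟩
    · rw [← inl_left_mul_inr_right s]
      exact B.mul_mem hs.1 hs.2
  · intro h
    ext s
    rw [mem_timesSubgroup, h s]
    refine and_congr_right fun _ => ⟨fun hs => ⟨_, hs, by simp⟩, ?_⟩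
    rintro ⟨b, hb, e⟩
    rw [← e]
    exact ((h b).1 hb).2

theorem mem_baseSubgroup {s : V ⋊[φ] G} : s ∈ baseSubgroup φ ↔ s.right = 1 := by
  constructor
  · rintro ⟨v, rfl⟩
    simp
  · intro h
    exact ⟨s.left, by ext <;> simp [h]⟩

theorem IsCentralSeries.le_of_le {S : Type*} [Group S] {n : ℕ} {Z : ℕ → Subgroup S}
    (hZ : IsCentralSeries n Z) {i j : ℕ} (hij : i ≤ j) (hj : j ≤ n) : Z i ≤ Z j := by
  induction j, hij using Nat.le_induction with
  | base => exact le_rfl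
  | succ j _ ih => exact (ih (by omega)).trans (hZ.le_succ j (by omega))

variable {p : ℕ} [Module (ZMod p) (Additive V)]

/-- The linear representation of `G` on `V`, written additively. -/
def linearRep (p : ℕ) [Module (ZMod p) (Additive V)] (φ : G →* MulAut V) :
    G →* Module.End (ZMod p) (Additive V) where
  toFun g := (MonoidHom.toAdditive (φ g).toMonoidHom).toZModLinearMap p
  map_one' := by ext v; simp
  map_mul' g h := by ext v; simp

theorem linearRep_apply (g : G) (v : V) :
    linearRep p φ g (Additive.ofMul v) = Additive.ofMul (φ g v) := rfl

theorem linearRep_injective (hφ : Function.Injective φ) : Function.Injective (linearRep p φ) := by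
  intro g h e
  refine hφ (MulEquiv.ext fun v => ?_)
  exact Additive.ofMul.injective (LinearMap.congr_fun e (Additive.ofMul v))

/-- `B ∩ V`, as a subspace of `V`. -/
def baseTrace (p : ℕ) [Module (ZMod p) (Additive V)] (B : Subgroup (V ⋊[φ] G)) :
    Submodule (ZMod p) (Additive V) :=
  AddSubgroup.toZModSubmodule p (Subgroup.toAddSubgroup (B.comap inl))

/-- `B ∩ G`. -/
def groupTrace (B : Subgroup (V ⋊[φ] G)) : Subgroup G := B.comap inr

theorem mem_baseTrace {B : Subgroup (V ⋊[φ] G)} {v : V} :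
    Additive.ofMul v ∈ baseTrace p B ↔ inl v ∈ B := Iff.rfl

theorem mem_groupTrace {B : Subgroup (V ⋊[φ] G)} {g : G} : g ∈ groupTrace B ↔ inr g ∈ B := Iff.rfl

variable [Fact p.Prime]

/-- The subgroup `U H` of `V ⋊ G`, where `H` centralizes `U`. -/
def pairGroup (U : Submodule (ZMod p) (Additive V)) (H : Subgroup G)
    (h : IsAbelianPair (linearRep p φ) U H) : Subgroup (V ⋊[φ] G) where
  carrier := {s | Additive.ofMul s.left ∈ U ∧ s.right ∈ H}
  mul_mem' := by
    rintro s t ⟨hs, hs'⟩ ⟨ht, ht'⟩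
    refine ⟨?_, H.mul_mem hs' ht'⟩
    have := U.add_mem hs ht
    rw [← h.2 s.right hs' _ ht] at this
    exact this
  one_mem' := ⟨U.zero_mem, H.one_mem⟩
  inv_mem' := by
    rintro s ⟨hs, hs'⟩
    refine ⟨?_, H.inv_mem hs'⟩
    have := U.neg_mem hs
    rw [← h.2 _ (H.inv_mem hs') _ (U.neg_mem hs)] at this
    exact this

theorem mem_pairGroup {U : Submodule (ZMod p) (Additive V)} {H : Subgroup G}
    {h : IsAbelianPair (linearRep p φ) U H} {s : V ⋊[φ] G} :
    s ∈ pairGroup U H h ↔ Additive.ofMul s.left ∈ U ∧ s.right ∈ H := Iff.rfl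

theorem isProductSubgroup_pairGroup {U : Submodule (ZMod p) (Additive V)} {H : Subgroup G}
    (h : IsAbelianPair (linearRep p φ) U H) : IsProductSubgroup (pairGroup U H h) := by
  rw [isProductSubgroup_iff]
  intro s
  simp [mem_pairGroup]

theorem isMulCommutative_pairGroup {U : Submodule (ZMod p) (Additive V)} {H : Subgroup G}
    (h : IsAbelianPair (linearRep p φ) U H) : IsMulCommutative (pairGroup U H h) := by
  refine ⟨⟨fun s t => Subtype.ext (SemidirectProduct.ext ?_ (h.1 _ s.2.2 _ t.2.2))⟩⟩
  have h1 : φ s.1.right t.1.left = t.1.left := h.2 _ s.2.2 _ t.2.1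
  have h2 : φ t.1.right s.1.left = s.1.left := h.2 _ t.2.2 _ s.2.1
  simp [h1, h2, mul_comm]

theorem card_pairGroup_inf {U : Submodule (ZMod p) (Additive V)} {H : Subgroup G}
    (h : IsAbelianPair (linearRep p φ) U H) {B : Subgroup (V ⋊[φ] G)}
    (hB : ∀ s, s ∈ B ↔ inl s.left ∈ B ∧ inr s.right ∈ B) :
    Nat.card ↥(pairGroup U H h ⊓ B) =
      Nat.card ↥(U ⊓ baseTrace p B) * Nat.card ↥(H ⊓ groupTrace B) := by
  rw [← Nat.card_prod]
  refine Nat.card_congr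
    { toFun := fun s => (⟨Additive.ofMul s.1.left, s.2.1.1, ((hB _).1 s.2.2).1⟩,
        ⟨s.1.right, s.2.1.2, ((hB _).1 s.2.2).2⟩)
      invFun := fun x => ⟨⟨x.1.1.toMul, x.2.1⟩, ⟨x.1.2.1, x.2.2.1⟩, (hB _).2 ⟨x.1.2.2, x.2.2.2⟩⟩
      left_inv := fun s => rfl
      right_inv := fun x => rfl }

theorem IsProductSubgroup.eq_pairGroup {A : Subgroup (V ⋊[φ] G)} (hA : IsProductSubgroup A)
    (h : IsAbelianPair (linearRep p φ) (baseTrace p A) (groupTrace A)) :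
    A = pairGroup (baseTrace p A) (groupTrace A) h := by
  ext s
  rw [isProductSubgroup_iff.1 hA s]
  rfl

theorem isAbelianPair_trace {A : Subgroup (V ⋊[φ] G)} (hA : IsMulCommutative A) :
    IsAbelianPair (linearRep p φ) (baseTrace p A) (groupTrace A) := by
  have hcomm : ∀ s ∈ A, ∀ t ∈ A, s * t = t * s := fun s hs t ht =>
    congrArg Subtype.val (hA.is_comm.comm (⟨s, hs⟩ : A) ⟨t, ht⟩)
  refine ⟨fun a ha b hb => ?_, fun a ha u hu => ?_⟩
  · have := hcomm _ ha _ hb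
    rw [← map_mul, ← map_mul] at this
    exact inr_injective this
  · have := congrArg SemidirectProduct.left (hcomm _ ha (inl u.toMul) hu)
    simp only [mul_left, left_inr, right_inr, left_inl, right_inl, map_one, mul_one, one_mul] at this
    exact this

variable {n : ℕ} {Z : ℕ → Subgroup (V ⋊[φ] G)}

theorem IsCentralSeries.le_or_le (hZ : IsCentralSeries n Z)
    (hZV : ∃ i ≤ n, Z i = baseSubgroup φ) {i : ℕ} (hi : i ≤ n) :
    Z i ≤ baseSubgroup φ ∨ baseSubgroup φ ≤ Z i := by
  obtain ⟨j, hj, e⟩ := hZV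
  rw [← e]
  rcases le_total i j with h | h
  · exact Or.inl (hZ.le_of_le h hj)
  · exact Or.inr (hZ.le_of_le h hi)

/-- Each term of the series is comparable with `V`, so it contains the components of its elements.
-/
theorem IsCentralSeries.mem_iff (hZ : IsCentralSeries n Z)
    (hZV : ∃ i ≤ n, Z i = baseSubgroup φ) {i : ℕ} (hi : i ≤ n) (s : V ⋊[φ] G) :
    s ∈ Z i ↔ inl s.left ∈ Z i ∧ inr s.right ∈ Z i := by
  have hs := inl_left_mul_inr_right s
  refine ⟨fun h => ?_, fun h => by rw [← hs]; exact mul_mem h.1 h.2⟩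
  rcases hZ.le_or_le hZV hi with hV | hV
  · have h1 := mem_baseSubgroup.1 (hV h)
    rw [h1, map_one, mul_one] at hs
    rw [hs, h1, map_one]
    exact ⟨h, one_mem _⟩
  · have h1 : inl s.left ∈ Z i := hV ⟨_, rfl⟩
    refine ⟨h1, ?_⟩
    have := mul_mem (inv_mem h1) h
    nth_rw 2 [← hs] at this
    rwa [inv_mul_cancel_left] at this

theorem IsCentralSeries.isCentralPairSeries (hZ : IsCentralSeries n Z)
    (hZV : ∃ i ≤ n, Z i = baseSubgroup φ) :
    IsCentralPairSeries (linearRep p φ) n (fun i => baseTrace p (Z i))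
      (fun i => groupTrace (Z i)) where
  left_zero := by
    rw [eq_bot_iff]
    intro v hv
    have hv : (inl v.toMul : V ⋊[φ] G) ∈ Z 0 := hv
    rw [hZ.bot, Subgroup.mem_bot] at hv
    exact inl_injective (φ := φ) (a₁ := v.toMul) (a₂ := 1) (hv.trans (map_one inl).symm)
  right_zero := by
    rw [eq_bot_iff]
    intro v hv
    have hv : (inr v : V ⋊[φ] G) ∈ Z 0 := hv
    rw [hZ.bot, Subgroup.mem_bot, ← map_one inr] at hv
    exact inr_injective hv
  left_last := by
    rw [eq_top_iff]
    intro v _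
    change (inl v.toMul : V ⋊[φ] G) ∈ Z n
    rw [hZ.top]
    trivial
  right_last := by rw [hZ.top]; rfl
  left_le i hi v hv := hZ.le_succ i hi hv
  right_le i hi v hv := hZ.le_succ i hi hv
  left_sub_mem i hi v hv g := by
    have h := (Z i).inv_mem (hZ.commutator_le i hi
      (Subgroup.commutator_mem_commutator hv (Subgroup.mem_top (inr g))))
    change (inl (φ g v.toMul / v.toMul) : V ⋊[φ] G) ∈ Z i
    convert h using 1
    rw [commutatorElement_inv, commutatorElement_def]
    change _ = inr g * inl v.toMul * (inr g)⁻¹ * (inl v.toMul)⁻¹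
    rw [← map_inv, ← inl_aut, ← map_inv, ← map_mul, div_eq_mul_inv]
  right_commutator_mem i hi z hz g := by
    change inr ⁅z, g⁆ ∈ Z i
    rw [map_commutatorElement]
    exact hZ.commutator_le i hi (Subgroup.commutator_mem_commutator hz (Subgroup.mem_top _))
  left_top_or i hi := by
    rcases hZ.le_or_le hZV hi with h | h
    · right
      rw [eq_bot_iff]
      intro g hg
      exact mem_baseSubgroup.1 (h hg)
    · left
      rw [eq_top_iff]
      intro v _
      exact h ⟨v.toMul, rfl⟩
  exists_split := by
    obtain ⟨j, hj, e⟩ := hZV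
    refine ⟨j, hj, ?_, ?_⟩
    · rw [eq_top_iff, e]
      intro v _
      exact ⟨v.toMul, rfl⟩
    · rw [eq_bot_iff, e]
      intro g hg
      exact mem_baseSubgroup.1 hg

theorem IsSeriesMaximal.isMaximalPair [Finite V] [Finite G] (hZ : IsCentralSeries n Z)
    (hZV : ∃ i ≤ n, Z i = baseSubgroup φ) {A : Subgroup (V ⋊[φ] G)}
    (hA : IsSeriesMaximal n Z (abelianProductSubgroups φ) A) :
    IsMaximalPair (linearRep p φ) n (fun i => baseTrace p (Z i)) (fun i => groupTrace (Z i))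
      (baseTrace p A) (groupTrace A) := by
  obtain ⟨⟨⟨hAc, hAmax⟩, hAp, hAV⟩, hmax⟩ := hA
  have hpair : IsAbelianPair (linearRep p φ) (baseTrace p A) (groupTrace A) :=
    isAbelianPair_trace hAc
  have hAe := hAp.eq_pairGroup hpair
  have hcard : ∀ (U : Submodule (ZMod p) (Additive V)) (H : Subgroup G)
      (h : IsAbelianPair (linearRep p φ) U H),
      Nat.card (pairGroup U H h) = Nat.card U * Nat.card H := by
    intro U H h
    have := card_pairGroup_inf h (B := ⊤) (fun s => by simp)
    have h1 : baseTrace p (⊤ : Subgroup (V ⋊[φ] G)) = ⊤ := rfl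
    have h2 : groupTrace (⊤ : Subgroup (V ⋊[φ] G)) = ⊤ := rfl
    rwa [h1, h2, inf_top_eq, inf_top_eq, inf_top_eq] at this
  have hcA : Nat.card A = Nat.card (baseTrace p A) * Nat.card (groupTrace A) := by
    rw [← hcard _ _ hpair, ← hAe]
  have hcAi : ∀ i ≤ n, Nat.card ↥(A ⊓ Z i) = Nat.card ↥(baseTrace p A ⊓ baseTrace p (Z i)) *
      Nat.card ↥(groupTrace A ⊓ groupTrace (Z i)) := by
    intro i hi
    rw [← card_pairGroup_inf hpair (hZ.mem_iff hZV hi), ← hAe]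
  have hle : ∀ (U : Submodule (ZMod p) (Additive V)) (H : Subgroup G)
      (h : IsAbelianPair (linearRep p φ) U H),
      Nat.card U * Nat.card H ≤ Nat.card (baseTrace p A) * Nat.card (groupTrace A) := by
    intro U H h
    rw [← hcA, ← hcard U H h]
    exact hAmax _ (isMulCommutative_pairGroup h)
  refine ⟨hpair, fun hbot => hAV fun s hs => ?_, hle, fun U H h hH hi => ?_⟩
  · have h1 : s.right ∈ groupTrace A := ((isProductSubgroup_iff.1 hAp s).1 hs).2
    rw [hbot] at h1
    exact mem_baseSubgroup.2 h1
  · have hi' : ∀ i ≤ n, Nat.card ↥(A ⊓ Z i) ≤ Nat.card ↥(pairGroup U H h ⊓ Z i) := by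
      intro i hin
      rw [hcAi i hin, card_pairGroup_inf h (hZ.mem_iff hZV hin)]
      exact hi i hin
    have hc : Nat.card A = Nat.card (pairGroup U H h) := by
      refine le_antisymm ?_ (hAmax _ (isMulCommutative_pairGroup h))
      have := hi' n le_rfl
      rwa [hZ.top, inf_top_eq, inf_top_eq] at this
    intro i hin
    rw [← hcAi i hin, ← card_pairGroup_inf h (hZ.mem_iff hZV hin)]
    by_contra hne
    refine hmax ⟨pairGroup U H h, ⟨⟨isMulCommutative_pairGroup h, fun B hB => ?_⟩,
      isProductSubgroup_pairGroup h, fun hV => ?_⟩, ⟨hc, fun i _ h => hi' i h⟩, i, ?_, hin,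
      lt_of_le_of_ne (hi' i hin) hne⟩
    · rw [← hc]
      exact hAmax B hB
    · refine hH (eq_bot_iff.2 fun g hg => ?_)
      have : (inr g : V ⋊[φ] G) ∈ pairGroup U H h := ⟨by simp, by simpa using hg⟩
      exact mem_baseSubgroup.1 (hV this)
    -- Strictness must occur at an index at least 1; at index 0 both intersections are trivial.
    · rcases i with _ | i
      · rw [hZ.bot, inf_bot_eq, inf_bot_eq] at hne
        exact absurd rfl hne
      · omega

theorem mem_commElement {S : Type*} [Group S] {X : Subgroup S} {x : S} (hx : x ∈ X) (u : S) :
    x⁻¹ * u⁻¹ * x * u ∈ commElement X u :=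
  Subgroup.subset_closure ⟨x, hx, rfl⟩

/-- An element `h` of `G` normalizes `A` if `h⁻¹` lies in some candidate subgroup. -/
theorem IsSeriesMaximal.conj_inr_mem [Finite V] [Finite G] (hp5 : 5 ≤ p)
    (hφ : Function.Injective φ) (hZ : IsCentralSeries n Z)
    (hZV : ∃ i ≤ n, Z i = baseSubgroup φ) {A : Subgroup (V ⋊[φ] G)}
    (hA : IsSeriesMaximal n Z (abelianProductSubgroups φ) A) {B : Subgroup (V ⋊[φ] G)}
    (hB : B ∈ normalizingCandidates A) {h : G} (hh : inr h ∈ B) {s : V ⋊[φ] G} (hs : s ∈ A) :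
    inr h * s * (inr h)⁻¹ ∈ A := by
  obtain ⟨-, hnorm, hcomm⟩ := hB
  -- The convention `[x, u] = x⁻¹ u⁻¹ x u` with `u = h⁻¹` produces left conjugation by `h`.
  have hu := hcomm _ (B.inv_mem hh)
  have hc3 : ∀ x ∈ A, ∀ c, c = x⁻¹ * (inr h * x * (inr h)⁻¹) →
      ∀ d, d = c⁻¹ * (inr h * c * (inr h)⁻¹) → d⁻¹ * (inr h * d * (inr h)⁻¹) = 1 := by
    rintro x hx c rfl d rfl
    have h1 := mem_commElement (mem_commElement (mem_commElement hx (inr h)⁻¹) (inr h)⁻¹) (inr h)⁻¹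
    change _ ∈ iterCommElement A (inr h)⁻¹ 3 at h1
    rw [hu, Subgroup.mem_bot] at h1
    simpa only [inv_inv, mul_assoc] using h1
  have key := (hA.isMaximalPair (p := p) hZ hZV).stable (h := h) hp5 (linearRep_injective hφ)
    (hZ.isCentralPairSeries hZV) ?_ ?_ ?_
  · have hsA := (isProductSubgroup_iff.1 hA.1.2.1 s).1 hs
    rw [isProductSubgroup_iff.1 hA.1.2.1]
    have h1 := key.1 (Additive.ofMul s.left) hsA.1
    have h2 := key.2 s.right hsA.2
    refine ⟨?_, ?_⟩
    · convert mem_baseTrace.1 h1 using 2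
      simp
    · convert mem_groupTrace.1 h2 using 2
      simp
  · intro i a ha b hb
    have hmem : ∀ (i : ℤ), ∀ b ∈ groupTrace A, inr (h ^ i * b * h ^ (-i)) ∈ conjClosure A B := by
      intro i b hb
      refine Subgroup.subset_closure ⟨inr b, hb, inr (h ^ (-i)), ?_, ?_⟩
      · rw [map_zpow]
        exact B.zpow_mem hh _
      · simp
    have h0 : inr a ∈ conjClosure A B := by simpa using hmem 0 a ha
    -- The conjugates of `A` by powers of `h` lie in `⟨A ^ B⟩`, which normalizes `A`.
    have := hnorm.conj_mem ⟨inr a, h0⟩ ha ⟨_, hmem i b hb⟩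
    rw [mem_groupTrace, map_mul, map_mul (f := inr) _ a, map_inv]
    exact this
  · rintro a ha c rfl d rfl
    have := hc3 (inr a) ha _ rfl _ rfl
    simp only [← map_mul, ← map_inv] at this
    have := inr_injective (this.trans (map_one inr).symm)
    exact (inv_mul_eq_one.1 this).symm
  · intro u hu
    have := hc3 (inl u.toMul) hu _ rfl _ rfl
    have e : ∀ v : V, (inl v)⁻¹ * ((inr h : V ⋊[φ] G) * inl v * (inr h)⁻¹) =
        inl (v⁻¹ * φ h v) := by
      intro v
      rw [← map_inv inr, ← inl_aut, ← map_inv, ← map_mul]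
    rw [e, e, e] at this
    have := inl_injective (this.trans (map_one inl).symm)
    have e' : ∀ v : V, (linearRep p φ h - 1) (Additive.ofMul v) =
        Additive.ofMul (v⁻¹ * φ h v) := fun v => by
      rw [LinearMap.sub_apply, linearRep_apply, Module.End.one_apply, sub_eq_neg_add]
      rfl
    rw [← ofMul_toMul u, e', e', e', this]
    rfl

/-- `V` normalizes `A`. -/
theorem IsSeriesMaximal.conj_inl_mem (p : ℕ) [Fact p.Prime]
    [Module (ZMod p) (Additive V)] [Finite V] [Finite G] (hZ : IsCentralSeries n Z)
    (hZV : ∃ i ≤ n, Z i = baseSubgroup φ) {A : Subgroup (V ⋊[φ] G)}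
    (hA : IsSeriesMaximal n Z (abelianProductSubgroups φ) A) (v : V) {s : V ⋊[φ] G} (hs : s ∈ A) :
    inl v * s * (inl v)⁻¹ ∈ A := by
  have hsA := (isProductSubgroup_iff.1 hA.1.2.1 s).1 hs
  have hq := (hA.isMaximalPair (p := p) hZ hZV).quadratic (hZ.isCentralPairSeries hZV) s.right
    hsA.2 (Additive.ofMul v)
  have h1 := (baseTrace p A).sub_mem hsA.1 hq
  rw [isProductSubgroup_iff.1 hA.1.2.1]
  refine ⟨?_, by simpa using hsA.2⟩
  have h2 : inl (s.left / (φ s.right v / v)) ∈ A := h1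
  convert h2 using 2
  simp [div_eq_mul_inv, mul_comm, mul_left_comm, mul_assoc]

end Translation

end ProductSubgroups

open ProductSubgroups in
theorem mainTheorem4 {p : ℕ} (hp : p.Prime) (hp5 : 5 ≤ p)
    {V G : Type*} [CommGroup V] [Finite V] (hV : ∀ v : V, v ^ p = 1)
    [Group G] [Finite G] (hG : IsPGroup p G)
    (φ : G →* MulAut V) (hφ : Function.Injective φ)
    (n : ℕ) (Z : ℕ → Subgroup (V ⋊[φ] G))
    (hZ : ProductSubgroups.IsCentralSeries n Z)
    (hZV : ∃ i ≤ n, Z i = ProductSubgroups.baseSubgroup φ)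
    (A : Subgroup (V ⋊[φ] G))
    (hA : ProductSubgroups.IsSeriesMaximal n Z (ProductSubgroups.abelianProductSubgroups φ) A) :
    ∀ B ∈ ProductSubgroups.normalizingCandidates A,
      B ≤ Subgroup.normalizer (A : Set (V ⋊[φ] G)) := by
  intro B hB b hb
  have : Fact p.Prime := ⟨hp⟩
  let : Module (ZMod p) (Additive V) := AddCommGroup.zmodModule fun v => hV v.toMul
  -- Only the `G`-component needs to lie in `B`; every element of `V` normalizes `A`.
  have hbB := (isProductSubgroup_iff.1 hB.1 b).1 hb
  rw [← SemidirectProduct.inl_left_mul_inr_right b]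
  refine mul_mem ?_ ?_
  · refine Subgroup.mem_normalizer_iff.2 fun s => ⟨fun hs => ?_, fun hs => ?_⟩
    · exact hA.conj_inl_mem p hZ hZV b.left hs
    · have := hA.conj_inl_mem p hZ hZV b.left⁻¹ hs
      simpa [mul_assoc] using this
  · refine Subgroup.mem_normalizer_iff.2 fun s => ⟨fun hs => ?_, fun hs => ?_⟩
    · exact hA.conj_inr_mem hp5 hφ hZ hZV hB hbB.2 hs
    · have := hA.conj_inr_mem hp5 hφ hZ hZV hB (h := b.right⁻¹)
        (by rw [map_inv]; exact B.inv_mem hbB.2) hs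
      simpa [mul_assoc] using this
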